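/- **Setting.** Let $K,N$ be integers with $N\ge K\ge 3$. A library consists of $N$ independent files $F_1,\dots,F_N$, each of $B$ independent uniform bits. Entropies $H$ and mutual informations $I$ are in bits. There are $K$ users; the demand vector $\mathbf D=(D_1,\dots,D_K)\in[N]^K$ has a fixed law that gives positive probability to every vector in $[N]^K$. A *scheme* works as follows. * *Placement.* User $k$ stores $Z_k=(\mathcal M(C_k),C_k)$, where $\mathcal M(C_k)$ (the metadata) takes finitely many values and describes how the cached content $C_k$ is composed from the files, so that $C_k$ is a function of $\mathcal M(C_k)$ and the library. The metadata of all users may be random and jointly distributed; they are independent of the demands and of the files. The placement is *uncoded*: for each value of $\mathcal M(C_k)$, $C_k$ is a list of bits copied from the files. * *Delivery.* A trusted server, which knows $\mathbf D$ and all cache metadata but does not have access to the library, chooses, possibly at random, metadata $\mathcal M(P_k)$ (with finitely many values) for every user $k$, which describe how the packets $P_k$ are composed from the files, so that $P_k$ is a function of $\mathcal M(P_k)$ and the library. User $k$ broadcasts $X_k=(\mathcal M(P_k),P_k)$. Write $\mathbf X=(X_1,\dots,X_K)$. For a cache size $M$, a load $R\in\mathbb R$ is *achievable* under uncoded placement and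 privacy against colluding users if there are $\epsilon_B\ge 0$ with $\lim_{B\to\infty}\epsilon_B=0$ such that for all sufficiently large $B$ there is a scheme with uncoded placement for which, for all $k\in[K]$, $$H(Z_k)\le B(M+\epsilon_B),\qquad H(X_k\mid \mathcal M(P_k),Z_k)=0,\qquad H(F_{D_k}\mid \mathbf X,Z_k,D_k)\le B\epsilon_B,$$ $$I\big(\mathbf D;\mathbf X,\{Z_k\}_{k\in S}\mid \{D_k\}_{k\in S}\big)=0\ \text{ for all } \emptyset\ne S\subseteq[K],\qquad \sum_{k\in[K]}H(X_k)\le B(R+\epsilon_B).$$ Let $R^\star_{\mathrm{u,c}}(M)$ be the infimum of the achievable loads. **Theorem.** Let $M=\frac NK+\frac{2y}{K}$ with $y\in[0,N/2]$. Then, for every integer $h$ with $0\le h\le\lfloor 2N/K-3\rfloor$ (there are such $h$ only if $N/K\ge 3/2$), $$R^\star_{\mathrm{u,c}}(M)\ \ge\ \frac{\lfloor K/2\rfloor}{\lceil K/2\rceil}\,\frac{\lfloor 2N/K\rfloor}{2N/K}\left(N-2y-\frac{4y+(N-\frac K2)h}{h+2}+\frac{h^2(N-\frac K2)-N(\frac{2N}{K}-3)+h(N+\frac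 K2)}{(h+1)(h+2)}\cdot\frac{2y}{N}\right),$$ and moreover $$R^\star_{\mathrm{u,c}}(M)\ \ge\ \frac{\lfloor K/2\rfloor}{\lceil K/2\rceil}\,K\left(1-\frac{3y}{N}\right),\qquad R^\star_{\mathrm{u,c}}(M)\ \ge\ \frac{\lfloor K/2\rfloor}{\lceil K/2\rceil}\,K\left(\frac12-\frac yN\right).$$ -/

import Mathlib

/-! Device-to-device coded caching with private demands and a trusted server. -/

noncomputable section

namespace D2D

open Filter Topology

/-! ### Shannon information measures (in bits) on a finite probability space

`P : Ω → ℝ` is the probability mass function of the finite sample space `Ω`; random variables are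
functions on `Ω`, with values in arbitrary types. -/

section Information

variable {Ω : Type*} [Fintype Ω] {α β γ : Type*}

open Classical in
/-- `H(X) = - ∑_ω P(ω) log₂ Pr[X = X(ω)] = - ∑_x Pr[X = x] log₂ Pr[X = x]`. -/
def entropy (P : Ω → ℝ) (X : Ω → α) : ℝ :=
  -∑ ω, P ω * Real.logb 2 (∑ ω', if X ω' = X ω then P ω' else 0)

/-- `H(X | Y) = H(X, Y) - H(Y)`. -/
def condEntropy (P : Ω → ℝ) (X : Ω → α) (Y : Ω → β) : ℝ :=
  entropy P (fun ω => (X ω, Y ω)) - entropy P Y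

/-- `I(X; Y | Z) = H(X | Z) - H(X | Y, Z)`. -/
def condMutualInfo (P : Ω → ℝ) (X : Ω → α) (Y : Ω → β) (Z : Ω → γ) : ℝ :=
  condEntropy P X Z - condEntropy P X (fun ω => (Y ω, Z ω))

end Information

/-- A library: `N` files of `B` bits each. -/
abbrev Library (N B : ℕ) : Type := Fin N → Fin B → Bool

/-- A demand vector: user `k` demands the file with index `d k`. -/
abbrev Demand (K N : ℕ) : Type := Fin K → Fin N

/-- A caching scheme for `K` users and `N` files of `B` bits, before any constraint is imposed. -/
structure Scheme (K N B : ℕ) where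
  /-- the alphabet of the metadata of the cache of user `k` -/
  CacheMeta : Fin K → Type
  /-- the alphabet of the metadata of the packets that user `k` broadcasts -/
  PacketMeta : Fin K → Type
  [fintypeCacheMeta : ∀ k, Fintype (CacheMeta k)]
  [fintypePacketMeta : ∀ k, Fintype (PacketMeta k)]
  /-- the cached content of user `k`: metadata describe how it is composed from the files -/
  content : ∀ k, CacheMeta k → Library N B → List Bool
  /-- the packets (payload) of user `k`: metadata describe how they are composed from the files -/
  payload : ∀ k, PacketMeta k → Library N B → List Bool
  /-- the joint law of the cache metadata of all users; neither demands nor files are used -/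
  placement : PMF (∀ k, CacheMeta k)
  /-- the (randomized) rule by which the trusted server, who knows the demands and the cache
  metadata but has no access to the library, chooses the packet metadata of all users -/
  delivery : Demand K N → (∀ k, CacheMeta k) → PMF (∀ k, PacketMeta k)

namespace Scheme

attribute [instance] Scheme.fintypeCacheMeta Scheme.fintypePacketMeta

variable {K N B : ℕ} (s : Scheme K N B)

/-- An outcome: demands, library, cache metadata of all users, packet metadata of all users. -/
abbrev Outcome : Type :=
  Demand K N × Library N B × (∀ k, s.CacheMeta k) × (∀ k, s.PacketMeta k)

/-- The joint probability mass function when the demand vector has law `PD`. The library is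
uniform (all bits are independent and fair) and independent of demands and metadata; the cache
metadata are independent of the demands; the packet metadata follow the rule of the server. -/
def prob (PD : PMF (Demand K N)) (ω : s.Outcome) : ℝ :=
  (PD ω.1).toReal * ((1 / 2 : ℝ) ^ (N * B)) * (s.placement ω.2.2.1).toReal *
    (s.delivery ω.1 ω.2.2.1 ω.2.2.2).toReal

/-- The demand vector `D`. -/
def D (ω : s.Outcome) : Demand K N := ω.1

/-- The file `F_n`. -/
def F (n : Fin N) (ω : s.Outcome) : Fin B → Bool := ω.2.1 n

/-- The metadata of the packets of user `k`. -/
def packetMeta (k : Fin K) (ω : s.Outcome) : s.PacketMeta k := ω.2.2.2 k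

/-- The cache `Z_k` of user `k`: metadata and content. -/
def Z (k : Fin K) (ω : s.Outcome) : s.CacheMeta k × List Bool :=
  (ω.2.2.1 k, s.content k (ω.2.2.1 k) ω.2.1)

/-- The signal `X_k` broadcast by user `k`: metadata and packets. -/
def X (k : Fin K) (ω : s.Outcome) : s.PacketMeta k × List Bool :=
  (ω.2.2.2 k, s.payload k (ω.2.2.2 k) ω.2.1)

/-- All broadcast signals. -/
def allX (ω : s.Outcome) : ∀ k, s.PacketMeta k × List Bool := fun k => s.X k ω

/-- Uncoded cache placement: each user directly copies some bits of the files. -/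
def IsUncoded : Prop :=
  ∀ (k : Fin K) (c : s.CacheMeta k), ∃ positions : List (Fin N × Fin B),
    ∀ f : Library N B, s.content k c f = positions.map (fun p => f p.1 p.2)

/-- Cache size constraint. -/
def CacheSize (PD : PMF (Demand K N)) (M ε : ℝ) : Prop :=
  ∀ k, entropy (s.prob PD) (s.Z k) ≤ B * (M + ε)

/-- Encoding constraint: user `k` computes its signal from its cache and its packet metadata. -/
def Encoding (PD : PMF (Demand K N)) : Prop :=
  ∀ k, condEntropy (s.prob PD) (s.X k) (fun ω => (s.packetMeta k ω, s.Z k ω)) = 0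

/-- Decoding constraint: user `k` recovers the file it demands. -/
def Decoding (PD : PMF (Demand K N)) (ε : ℝ) : Prop :=
  ∀ k, condEntropy (s.prob PD) (fun ω => s.F (s.D ω k) ω)
    (fun ω => (s.allX ω, s.Z k ω, s.D ω k)) ≤ B * ε

/-- Privacy against colluding users: the signals together with the caches of any nonempty set `S`
of users reveal nothing about the demand vector beyond the demands of the users in `S`. -/
def CollusionPrivacy (PD : PMF (Demand K N)) : Prop :=
  ∀ S : Finset (Fin K), S.Nonempty →
    condMutualInfo (s.prob PD) s.D
      (fun ω => (s.allX ω, fun k : S => s.Z k ω))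
      (fun ω => fun k : S => s.D ω k) = 0

/-- Load constraint. -/
def Load (PD : PMF (Demand K N)) (R ε : ℝ) : Prop :=
  ∑ k, entropy (s.prob PD) (s.X k) ≤ B * (R + ε)

end Scheme

/-- The load `R` is achievable with cache size `M`, under uncoded cache placement and privacy
against colluding users, when the demand vector has law `PD`. -/
def AchievableUC (K N : ℕ) (PD : PMF (Demand K N)) (M R : ℝ) : Prop :=
  ∃ ε : ℕ → ℝ, (∀ B, 0 ≤ ε B) ∧ Tendsto ε atTop (𝓝 0) ∧
    ∀ᶠ B in atTop, ∃ s : Scheme K N B,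
      s.IsUncoded ∧ s.CacheSize PD M (ε B) ∧ s.Encoding PD ∧ s.Decoding PD (ε B) ∧
        s.CollusionPrivacy PD ∧ s.Load PD R (ε B)

/-- The optimal load `R*_{u,c}(M)`: the infimum of the achievable loads (`⊤` if there is none). -/
def optimalLoadUC (K N : ℕ) (PD : PMF (Demand K N)) (M : ℝ) : EReal :=
  sInf {r : EReal | ∃ R : ℝ, AchievableUC K N PD M R ∧ r = (R : EReal)}

end D2D

end

/-! Put the first `m = ⌊K/2⌋` users in one group and the remaining users in another, and consider
only demand vectors in which both groups ask for the same block of `m` files. Take `n` such demands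
with pairwise disjoint blocks, `n * m ≤ N`. Each group then acts as a single transmitter: the
signals `V₁` of one group and the caches of the other determine the block, and vice versa.

Privacy forces the packet metadata to have the same law for all demands
(`CollusionPrivacy.sum_metaLaw_eq`). Hence one realization of the packets must serve all `n` blocks,
with cached bits `A j`, `C j` of the two groups that may vary with the block `j`. The chain rule,
applied to the blocks in a random order (`entropy_ge_chain`, `entropy_ge_average`), counts a bit of
block `j` outside `C j` that lies in `x` other sets `C i` with probability `1 / (x + 1)`. The
parameter `h` selects a linear minorant of this function of `x` (`weights_le_inv`).

The decisive point is `two_transmitter_converse`. Since `V₁` is a function of `A j` for every `j`,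
it depends only on the intersection of these sets. So, up to decoding errors, a bit of block `j`
missing from `C j` lies in every `A i`, and if it also lies in `C i`, it is cached in both groups.
Adding the bounds for `V₁` and `V₂` charges each such overlap only once, and the `i`-th term of the
result involves only the caches for demand `i`. This separation allows averaging each cache
realization on its own (`sum_average_le`), which leads back to the placement law, the same for all
demands.

After averaging over cyclic shifts of the files, only the expected number of commonly cached bits
matters. The two groups together must cache almost the whole library, so this number is about `K * M
* B - N * B = 2 * y * B` at most. Letting `B → ∞` gives `AchievableUC.blockBound_le`. The three
claims are the cases `n = ⌊2N/K⌋`, `2`, `1`; `mul_blockBound_le` and `half_ratio_mul_le` absorb the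
rounding. -/

open Finset

namespace D2D

/-! ### Shannon inequalities -/

section Toolkit

variable {Ω : Type*} [Fintype Ω] {α β γ δ : Type*} {P : Ω → ℝ}

open Classical in
/-- The probability that `X` takes the value `x`. -/
noncomputable def mass (P : Ω → ℝ) (X : Ω → α) (x : α) : ℝ := ∑ ω, if X ω = x then P ω else 0

theorem entropy_eq_mass (P : Ω → ℝ) (X : Ω → α) :
    entropy P X = -∑ ω, P ω * Real.logb 2 (mass P X (X ω)) := rfl

theorem mass_nonneg (hP : ∀ ω, 0 ≤ P ω) (X : Ω → α) (x : α) : 0 ≤ mass P X x :=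
  sum_nonneg fun ω _ => by split_ifs <;> simp [hP]

theorem le_mass_self (hP : ∀ ω, 0 ≤ P ω) (X : Ω → α) (ω : Ω) : P ω ≤ mass P X (X ω) := by
  classical
  have := single_le_sum (f := fun ω' => if X ω' = X ω then P ω' else 0)
    (fun ω' _ => by split_ifs <;> simp [hP]) (mem_univ ω)
  simpa [mass] using this

theorem mass_pos (hP : ∀ ω, 0 ≤ P ω) (X : Ω → α) {ω : Ω} (hω : P ω ≠ 0) :
    0 < mass P X (X ω) :=
  ((hP ω).lt_of_ne' hω).trans_le (le_mass_self hP X ω)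

theorem mass_mono (hP : ∀ ω, 0 ≤ P ω) {X : Ω → α} {Y : Ω → β} {x : α} {y : β}
    (h : ∀ ω, X ω = x → Y ω = y) : mass P X x ≤ mass P Y y := by
  classical
  refine sum_le_sum fun ω _ => ?_
  by_cases hx : X ω = x
  · simp [hx, h ω hx]
  · simp only [hx, if_false]
    split_ifs <;> simp [hP]

theorem mass_congr {X : Ω → α} {Y : Ω → β} {x : α} {y : β}
    (h : ∀ ω, X ω = x ↔ Y ω = y) : mass P X x = mass P Y y := by
  classical
  simp only [mass, h]

/-- The entropy depends only on the partition induced by the random variable. -/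
theorem entropy_congr {X : Ω → α} {Y : Ω → β} (h : ∀ ω ω', X ω' = X ω ↔ Y ω' = Y ω) :
    entropy P X = entropy P Y := by
  simp only [entropy_eq_mass]
  congr 1
  exact sum_congr rfl fun ω _ => by rw [mass_congr (h ω)]

theorem entropy_mono (hP : ∀ ω, 0 ≤ P ω) {X : Ω → α} {Y : Ω → β}
    (h : ∀ ω ω', X ω' = X ω → Y ω' = Y ω) : entropy P Y ≤ entropy P X := by
  simp only [entropy_eq_mass]
  refine neg_le_neg (sum_le_sum fun ω _ => ?_)
  rcases eq_or_ne (P ω) 0 with h0 | h0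
  · simp [h0]
  · exact mul_le_mul_of_nonneg_left
      (Real.logb_le_logb_of_le one_lt_two (mass_pos hP X h0) (mass_mono hP (h ω))) (hP ω)

theorem entropy_const (h1 : ∑ ω, P ω = 1) (c : α) : entropy P (fun _ => c) = 0 := by
  simp [entropy_eq_mass, mass, h1]

theorem entropy_nonneg (hP : ∀ ω, 0 ≤ P ω) (h1 : ∑ ω, P ω = 1) (X : Ω → α) :
    0 ≤ entropy P X := by
  rw [← entropy_const h1 ()]
  exact entropy_mono hP fun _ _ _ => rfl

/-- If `X` adds no entropy to `Y` under a law of full support, it is a function of `Y`. -/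
theorem eq_of_condEntropy_eq_zero (hP : ∀ ω, 0 < P ω) {X : Ω → α} {Y : Ω → β}
    (h : condEntropy P X Y = 0) {ω ω' : Ω} (hY : Y ω' = Y ω) : X ω' = X ω := by
  classical
  have hP0 : ∀ ω, 0 ≤ P ω := fun ω => (hP ω).le
  set XY : Ω → α × β := fun ω => (X ω, Y ω) with hXY
  have hle : ∀ ω ∈ univ, P ω * Real.logb 2 (mass P XY (XY ω)) ≤
      P ω * Real.logb 2 (mass P Y (Y ω)) := fun ω _ =>
    mul_le_mul_of_nonneg_left (Real.logb_le_logb_of_le one_lt_two (mass_pos hP0 XY (hP ω).ne')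
      (mass_mono hP0 fun ω' hω' => (Prod.ext_iff.1 hω').2)) (hP0 ω)
  have hsum : ∑ ω, P ω * Real.logb 2 (mass P XY (XY ω)) =
      ∑ ω, P ω * Real.logb 2 (mass P Y (Y ω)) := by
    have h' : entropy P XY - entropy P Y = 0 := h
    simp only [entropy_eq_mass] at h'
    linarith
  have heq := (sum_eq_sum_iff_of_le hle).1 hsum ω (mem_univ _)
  have hlog := mul_left_cancel₀ (hP ω).ne' heq
  have hm : mass P XY (XY ω) = mass P Y (Y ω) :=
    Real.logb_injOn_pos one_lt_two (mass_pos hP0 XY (hP ω).ne')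
      (mass_pos hP0 Y (hP ω).ne') hlog
  by_contra hne
  have : mass P XY (XY ω) < mass P Y (Y ω) := by
    refine sum_lt_sum (fun v _ => ?_) ⟨ω', mem_univ _, ?_⟩
    · by_cases hv : XY v = XY ω
      · have : Y v = Y ω := (Prod.ext_iff.1 hv).2
        simp [hv, this]
      · simp only [hv, if_false]
        split_ifs <;> simp [hP0]
    · have hv : XY ω' ≠ XY ω := fun e => hne (Prod.ext_iff.1 e).1
      simp [hv, hY, hP]
  exact this.ne hm

open Classical in
/-- The auxiliary sum in the proof of the nonnegativity of conditional mutual information. -/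
theorem sum_mass_ratio (P : Ω → ℝ) (X : Ω → α) (Y : Ω → β) (Z : Ω → γ) (v : γ → ℝ) :
    ∑ ω, P ω * (mass P (fun ω => (X ω, Z ω)) (X ω, Z ω) *
        mass P (fun ω => (Y ω, Z ω)) (Y ω, Z ω) *
        (mass P (fun ω => (X ω, Y ω, Z ω)) (X ω, Y ω, Z ω))⁻¹ * v (Z ω)) =
      ∑ ω₁, ∑ ω₂, if Z ω₂ = Z ω₁ then P ω₁ * P ω₂ * v (Z ω₁) *
        (mass P (fun ω => (X ω, Y ω, Z ω)) (X ω₁, Y ω₂, Z ω₁) *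
          (mass P (fun ω => (X ω, Y ω, Z ω)) (X ω₁, Y ω₂, Z ω₁))⁻¹) else 0 := by
  set T : Ω → α × β × γ := fun ω => (X ω, Y ω, Z ω) with hT
  have hL : ∀ ω, P ω * (mass P (fun ω => (X ω, Z ω)) (X ω, Z ω) *
      mass P (fun ω => (Y ω, Z ω)) (Y ω, Z ω) * (mass P T (T ω))⁻¹ * v (Z ω)) =
      ∑ ω₁, ∑ ω₂, (if (X ω₁, Z ω₁) = (X ω, Z ω) then P ω₁ else 0) *
        (if (Y ω₂, Z ω₂) = (Y ω, Z ω) then P ω₂ else 0) *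
        (P ω * (mass P T (T ω))⁻¹ * v (Z ω)) := fun ω => by
    simp only [← sum_mul, ← mul_sum, mass]
    ring_nf
  rw [sum_congr rfl fun ω _ => hL ω, sum_comm]
  refine sum_congr rfl fun ω₁ _ => ?_
  rw [sum_comm]
  refine sum_congr rfl fun ω₂ _ => ?_
  split_ifs with hz
  · conv_rhs => enter [2, 1]; rw [mass]
    rw [sum_mul, mul_sum]
    refine sum_congr rfl fun ω _ => ?_
    by_cases h : T ω = (X ω₁, Y ω₂, Z ω₁)
    · have h' := h
      simp only [hT, Prod.mk.injEq] at h'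
      obtain ⟨hx, hy, hz'⟩ := h'
      simp only [← hx, ← hy, ← hz', hz, hT]
      simp only [hx, hy, hz', if_true]
      ring
    · have h' := h
      simp only [hT, Prod.mk.injEq] at h'
      simp only [h, if_false, zero_mul, mul_zero, Prod.mk.injEq]
      by_cases hx : X ω₁ = X ω ∧ Z ω₁ = Z ω
      · have hy : ¬ (Y ω₂ = Y ω ∧ Z ω₂ = Z ω) := fun hy =>
          h' ⟨hx.1.symm, hy.1.symm, hx.2.symm⟩
        simp [hy]
      · simp [hx]
  · refine sum_eq_zero fun ω _ => ?_
    by_cases hx : X ω₁ = X ω ∧ Z ω₁ = Z ω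
    · have hy : ¬ (Y ω₂ = Y ω ∧ Z ω₂ = Z ω) := fun hy => hz (hy.2.trans hx.2.symm)
      simp [hy]
    · simp [hx]

theorem condMutualInfo_eq_sum (P : Ω → ℝ) (X : Ω → α) (Y : Ω → β) (Z : Ω → γ) :
    condMutualInfo P X Y Z = ∑ ω, P ω *
      (Real.logb 2 (mass P (fun ω => (X ω, Y ω, Z ω)) (X ω, Y ω, Z ω)) +
        Real.logb 2 (mass P Z (Z ω)) -
        Real.logb 2 (mass P (fun ω => (X ω, Z ω)) (X ω, Z ω)) -
        Real.logb 2 (mass P (fun ω => (Y ω, Z ω)) (Y ω, Z ω))) := by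
  simp only [condMutualInfo, condEntropy, entropy_eq_mass, mul_sub, mul_add, sum_sub_distrib,
    sum_add_distrib]
  ring

/-- The likelihood ratio of the conditionally independent law and the joint law. -/
noncomputable def ratio (P : Ω → ℝ) (X : Ω → α) (Y : Ω → β) (Z : Ω → γ) (ω : Ω) : ℝ :=
  mass P (fun ω => (X ω, Z ω)) (X ω, Z ω) * mass P (fun ω => (Y ω, Z ω)) (Y ω, Z ω) *
    (mass P (fun ω => (X ω, Y ω, Z ω)) (X ω, Y ω, Z ω))⁻¹ * (mass P Z (Z ω))⁻¹

theorem ratio_pos (hP : ∀ ω, 0 ≤ P ω) (X : Ω → α) (Y : Ω → β) (Z : Ω → γ) {ω : Ω}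
    (hω : P ω ≠ 0) : 0 < ratio P X Y Z ω := by
  have h1 := mass_pos hP (fun ω => (X ω, Z ω)) hω
  have h2 := mass_pos hP (fun ω => (Y ω, Z ω)) hω
  have h3 := mass_pos hP (fun ω => (X ω, Y ω, Z ω)) hω
  have h4 := mass_pos hP Z hω
  unfold ratio
  positivity

theorem condMutualInfo_eq_log_ratio (hP : ∀ ω, 0 ≤ P ω) (X : Ω → α) (Y : Ω → β) (Z : Ω → γ) :
    condMutualInfo P X Y Z = (Real.log 2)⁻¹ * ∑ ω, P ω * (-Real.log (ratio P X Y Z ω)) := by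
  rw [condMutualInfo_eq_sum, mul_sum]
  refine sum_congr rfl fun ω _ => ?_
  rcases eq_or_ne (P ω) 0 with h0 | h0
  · simp [h0]
  have h1 := mass_pos hP (fun ω => (X ω, Z ω)) h0
  have h2 := mass_pos hP (fun ω => (Y ω, Z ω)) h0
  have h3 := mass_pos hP (fun ω => (X ω, Y ω, Z ω)) h0
  have h4 := mass_pos hP Z h0
  rw [ratio, Real.log_mul (by positivity) (by positivity), Real.log_mul (by positivity)
    (by positivity), Real.log_mul (by positivity) (by positivity), Real.log_inv, Real.log_inv]
  simp only [Real.logb]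
  field_simp
  ring

-- Both sums expand over pairs `ω₁`, `ω₂` with equal `Z`. The total mass gives every pair its
-- weight, while the sum of the ratios keeps only the pairs whose recombined value `(X ω₁, Y ω₂, Z
-- ω₁)` has positive probability. The difference is visibly nonnegative, and its vanishing controls
-- the values off the support of the joint law.
open Classical in
theorem sum_ratio_defect (hP : ∀ ω, 0 ≤ P ω) (X : Ω → α) (Y : Ω → β) (Z : Ω → γ) :
    ∑ ω, P ω * (1 - ratio P X Y Z ω) = ∑ ω₁, ∑ ω₂,
      if Z ω₂ = Z ω₁ ∧ mass P (fun ω => (X ω, Y ω, Z ω)) (X ω₁, Y ω₂, Z ω₁) = 0 then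
        P ω₁ * P ω₂ * (mass P Z (Z ω₁))⁻¹ else 0 := by
  have h1 : ∑ ω, P ω = ∑ ω₁, ∑ ω₂, if Z ω₂ = Z ω₁ then
      P ω₁ * P ω₂ * (mass P Z (Z ω₁))⁻¹ else 0 := by
    refine sum_congr rfl fun ω₁ _ => ?_
    rcases eq_or_ne (P ω₁) 0 with h0 | h0
    · simp [h0]
    have h4 := (mass_pos hP Z h0).ne'
    calc P ω₁ = P ω₁ * mass P Z (Z ω₁) * (mass P Z (Z ω₁))⁻¹ := by field_simp
      _ = _ := by
        conv_lhs => rw [mul_assoc, mul_comm, mass, sum_mul, sum_mul]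
        refine sum_congr rfl fun ω₂ _ => ?_
        split_ifs
        · rw [mass]; ring
        · ring
  simp only [mul_sub, mul_one, sum_sub_distrib]
  simp only [ratio]
  rw [sum_mass_ratio P X Y Z fun z => (mass P Z z)⁻¹, h1, ← sum_sub_distrib]
  refine sum_congr rfl fun ω₁ _ => ?_
  rw [← sum_sub_distrib]
  refine sum_congr rfl fun ω₂ _ => ?_
  by_cases hz : Z ω₂ = Z ω₁
  · by_cases hm : mass P (fun ω => (X ω, Y ω, Z ω)) (X ω₁, Y ω₂, Z ω₁) = 0
    · simp [hz, hm]
    · simp [hz, hm]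
  · simp [hz]

theorem condMutualInfo_terms_nonneg (hP : ∀ ω, 0 ≤ P ω) (X : Ω → α) (Y : Ω → β) (Z : Ω → γ)
    (ω : Ω) :
    P ω * (1 - ratio P X Y Z ω) ≤ P ω * (-Real.log (ratio P X Y Z ω)) := by
  rcases eq_or_ne (P ω) 0 with h0 | h0
  · simp [h0]
  have := Real.log_le_sub_one_of_pos (ratio_pos hP X Y Z h0)
  exact mul_le_mul_of_nonneg_left (by linarith) (hP ω)

open Classical in
theorem defect_nonneg (hP : ∀ ω, 0 ≤ P ω) (X : Ω → α) (Y : Ω → β) (Z : Ω → γ) (ω₁ ω₂ : Ω) :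
    0 ≤ if Z ω₂ = Z ω₁ ∧ mass P (fun ω => (X ω, Y ω, Z ω)) (X ω₁, Y ω₂, Z ω₁) = 0 then
        P ω₁ * P ω₂ * (mass P Z (Z ω₁))⁻¹ else 0 := by
  have h := mass_nonneg hP Z (Z ω₁)
  have h1 := hP ω₁
  have h2 := hP ω₂
  split_ifs
  · positivity
  · exact le_rfl

theorem condMutualInfo_nonneg (hP : ∀ ω, 0 ≤ P ω) (X : Ω → α) (Y : Ω → β) (Z : Ω → γ) :
    0 ≤ condMutualInfo P X Y Z := by
  rw [condMutualInfo_eq_log_ratio hP]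
  refine mul_nonneg (inv_nonneg.2 (Real.log_nonneg one_le_two)) ?_
  refine le_trans ?_ (sum_le_sum fun ω _ => condMutualInfo_terms_nonneg hP X Y Z ω)
  rw [sum_ratio_defect hP]
  exact sum_nonneg fun ω₁ _ => sum_nonneg fun ω₂ _ => defect_nonneg hP X Y Z ω₁ ω₂

theorem exists_of_mass_ne_zero {X : Ω → α} {x : α} (h : mass P X x ≠ 0) :
    ∃ ω, P ω ≠ 0 ∧ X ω = x := by
  classical
  obtain ⟨ω, -, hω⟩ := exists_ne_zero_of_sum_ne_zero h
  refine ⟨ω, ?_, ?_⟩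
  · rintro h0; simp [h0] at hω
  · by_contra hx; simp [hx] at hω

/-- Vanishing conditional mutual information means conditional independence. -/
theorem mass_mul_mass_of_condMutualInfo_eq_zero (hP : ∀ ω, 0 ≤ P ω) {X : Ω → α} {Y : Ω → β}
    {Z : Ω → γ} (h : condMutualInfo P X Y Z = 0) (x : α) (y : β) (z : γ) :
    mass P (fun ω => (X ω, Y ω, Z ω)) (x, y, z) * mass P Z z =
      mass P (fun ω => (X ω, Z ω)) (x, z) * mass P (fun ω => (Y ω, Z ω)) (y, z) := by
  classical
  rw [condMutualInfo_eq_log_ratio hP] at h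
  have hlog2 : (Real.log 2)⁻¹ ≠ 0 := inv_ne_zero (Real.log_pos one_lt_two).ne'
  have hsum : ∑ ω, P ω * (-Real.log (ratio P X Y Z ω)) = 0 :=
    (mul_eq_zero.1 h).resolve_left hlog2
  have hle := sum_le_sum fun ω (_ : ω ∈ univ) => condMutualInfo_terms_nonneg hP X Y Z ω
  have hnn : ∀ ω₁ ∈ univ, 0 ≤ ∑ ω₂, if Z ω₂ = Z ω₁ ∧
      mass P (fun ω => (X ω, Y ω, Z ω)) (X ω₁, Y ω₂, Z ω₁) = 0 then
        P ω₁ * P ω₂ * (mass P Z (Z ω₁))⁻¹ else 0 := fun ω₁ _ =>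
    sum_nonneg fun ω₂ _ => defect_nonneg hP X Y Z ω₁ ω₂
  have hdef : ∑ ω, P ω * (1 - ratio P X Y Z ω) = 0 := by
    refine le_antisymm (hle.trans hsum.le) ?_
    rw [sum_ratio_defect hP]
    exact sum_nonneg hnn
  have hterm := (sum_eq_sum_iff_of_le fun ω (_ : ω ∈ univ) =>
    condMutualInfo_terms_nonneg hP X Y Z ω).1 (hdef.trans hsum.symm)
  rw [sum_ratio_defect hP] at hdef
  -- Off the joint support the ratio says nothing: there the vanishing defect forbids recombining
  -- two outcomes. On the support, equality in `log r ≤ r - 1` forces the ratio to be `1`.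
  by_cases hm : mass P (fun ω => (X ω, Y ω, Z ω)) (x, y, z) = 0
  · rw [hm, zero_mul]
    by_contra hne
    obtain ⟨hx, hy⟩ := mul_ne_zero_iff.1 (Ne.symm hne)
    obtain ⟨ω₁, h1, e1⟩ := exists_of_mass_ne_zero hx
    obtain ⟨ω₂, h2, e2⟩ := exists_of_mass_ne_zero hy
    simp only [Prod.mk.injEq] at e1 e2
    have h0 := (sum_eq_zero_iff_of_nonneg hnn).1 hdef ω₁ (mem_univ _)
    have h0 := (sum_eq_zero_iff_of_nonneg fun ω₂ _ => defect_nonneg hP X Y Z ω₁ ω₂).1 h0 ω₂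
      (mem_univ _)
    rw [if_pos ⟨e2.2.trans e1.2.symm, by rw [e1.1, e2.1, e1.2]; exact hm⟩] at h0
    exact mul_ne_zero (mul_ne_zero h1 h2) (inv_ne_zero (mass_pos hP Z h1).ne') h0
  · obtain ⟨ω, h0, e⟩ := exists_of_mass_ne_zero hm
    simp only [Prod.mk.injEq] at e
    obtain ⟨rfl, rfl, rfl⟩ := e
    have ht := mul_left_cancel₀ h0 (hterm ω (mem_univ _))
    have hr : ratio P X Y Z ω = 1 := by
      by_contra hne
      have := Real.log_lt_sub_one_of_pos (ratio_pos hP X Y Z h0) hne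
      linarith
    have h3 := (mass_pos hP (fun ω => (X ω, Y ω, Z ω)) h0).ne'
    have h4 := (mass_pos hP Z h0).ne'
    rw [ratio] at hr
    field_simp at hr
    linarith

/-- Strong subadditivity. -/
theorem entropy_submodular (hP : ∀ ω, 0 ≤ P ω) (X : Ω → α) (Y : Ω → β) (Z : Ω → γ) :
    entropy P (fun ω => (X ω, Y ω, Z ω)) + entropy P Z ≤
      entropy P (fun ω => (X ω, Z ω)) + entropy P (fun ω => (Y ω, Z ω)) := by
  have := condMutualInfo_nonneg hP X Y Z
  simp only [condMutualInfo, condEntropy] at this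
  linarith

/-- Conditioning on more reduces the entropy. -/
theorem condEntropy_anti (hP : ∀ ω, 0 ≤ P ω) (X : Ω → α) {Y : Ω → β} {Z : Ω → γ}
    (h : ∀ ω ω', Z ω' = Z ω → Y ω' = Y ω) : condEntropy P X Z ≤ condEntropy P X Y := by
  have h1 := entropy_submodular hP X Z Y
  have h2 : entropy P (fun ω => (X ω, Z ω, Y ω)) = entropy P (fun ω => (X ω, Z ω)) :=
    entropy_congr fun ω ω' => by
      simp only [Prod.mk.injEq]
      exact ⟨fun e => ⟨e.1, e.2.1⟩, fun e => ⟨e.1, e.2, h _ _ e.2⟩⟩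
  have h3 : entropy P (fun ω => (Z ω, Y ω)) = entropy P Z :=
    entropy_congr fun ω ω' => by
      simp only [Prod.mk.injEq]
      exact ⟨fun e => e.1, fun e => ⟨e, h _ _ e⟩⟩
  simp only [condEntropy]
  linarith

theorem condEntropy_nonneg (hP : ∀ ω, 0 ≤ P ω) (X : Ω → α) (Y : Ω → β) :
    0 ≤ condEntropy P X Y :=
  sub_nonneg.2 (entropy_mono hP fun _ _ e => (Prod.ext_iff.1 e).2)

theorem condEntropy_congr {X : Ω → α} {X' : Ω → γ} {Y : Ω → β} {Y' : Ω → δ}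
    (hY : ∀ ω ω', Y ω' = Y ω ↔ Y' ω' = Y' ω)
    (hX : ∀ ω ω', Y ω' = Y ω → (X ω' = X ω ↔ X' ω' = X' ω)) :
    condEntropy P X Y = condEntropy P X' Y' := by
  unfold condEntropy
  rw [entropy_congr hY, entropy_congr (X := fun ω => (X ω, Y ω)) (Y := fun ω => (X' ω, Y' ω))]
  intro ω ω'
  simp only [Prod.mk.injEq, ← hY]
  exact ⟨fun e => ⟨(hX _ _ e.2).1 e.1, e.2⟩, fun e => ⟨(hX _ _ e.2).2 e.1, e.2⟩⟩

theorem condEntropy_le_of_imp (hP : ∀ ω, 0 ≤ P ω) {X : Ω → α} {X' : Ω → γ} {Y : Ω → β}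
    (h : ∀ ω ω', Y ω' = Y ω → X' ω' = X' ω → X ω' = X ω) :
    condEntropy P X Y ≤ condEntropy P X' Y := by
  refine sub_le_sub_right (entropy_mono hP fun ω ω' e => ?_) _
  obtain ⟨e1, e2⟩ := Prod.ext_iff.1 e
  exact Prod.ext (h _ _ e2 e1) e2

theorem condEntropy_const (h1 : ∑ ω, P ω = 1) (X : Ω → α) (c : β) :
    condEntropy P X (fun _ => c) = entropy P X := by
  rw [condEntropy, entropy_const h1, sub_zero]
  exact entropy_congr fun _ _ => by simp

/-- Data processing for a function of the second variable. -/
theorem condMutualInfo_eq_zero_of_imp (hP : ∀ ω, 0 ≤ P ω) {X : Ω → α} {Y : Ω → β} {Y' : Ω → δ}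
    {Z : Ω → γ} (h : condMutualInfo P X Y Z = 0) (hY : ∀ ω ω', Y ω' = Y ω → Y' ω' = Y' ω) :
    condMutualInfo P X Y' Z = 0 := by
  refine le_antisymm ?_ (condMutualInfo_nonneg hP X Y' Z)
  rw [← h]
  refine sub_le_sub_left (condEntropy_anti hP X fun ω ω' e => ?_) _
  obtain ⟨e1, e2⟩ := Prod.ext_iff.1 e
  exact Prod.ext (hY _ _ e1) e2

/-- Conditional subadditivity for tuples. -/
theorem condEntropy_tuple_le (hP : ∀ ω, 0 ≤ P ω) {κ : Type*}
    {ξ : κ → Type*} (X : ∀ k, Ω → ξ k) (Y : Ω → β) (S : Finset κ) :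
    condEntropy P (fun ω (k : S) => X k ω) Y ≤ ∑ k ∈ S, condEntropy P (X k) Y := by
  classical
  induction S using Finset.induction_on with
  | empty =>
    rw [sum_empty, condEntropy, sub_nonpos]
    refine entropy_mono hP fun ω ω' e => Prod.ext ?_ e
    funext k
    exact absurd k.2 (notMem_empty _)
  | insert a S ha ih =>
    rw [sum_insert ha]
    have hs := entropy_submodular hP (X a) (fun ω (k : S) => X k ω) Y
    have he : entropy P (fun ω => ((fun k : (insert a S : Finset κ) => X k ω), Y ω)) ≤
        entropy P (fun ω => (X a ω, (fun k : S => X k ω), Y ω)) := by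
      refine entropy_mono hP fun ω ω' e => ?_
      simp only [Prod.mk.injEq] at e ⊢
      refine ⟨?_, e.2.2⟩
      funext ⟨k, hk⟩
      rcases mem_insert.1 hk with rfl | hk
      · exact e.1
      · exact congrFun e.2.1 ⟨k, hk⟩
    simp only [condEntropy] at ih ⊢
    linarith

theorem entropy_tuple_le (hP : ∀ ω, 0 ≤ P ω) (h1 : ∑ ω, P ω = 1) {κ : Type*}
    {ξ : κ → Type*} (X : ∀ k, Ω → ξ k) (S : Finset κ) :
    entropy P (fun ω (k : S) => X k ω) ≤ ∑ k ∈ S, entropy P (X k) := by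
  simpa only [condEntropy_const h1] using condEntropy_tuple_le hP X (fun _ => ()) S

end Toolkit

/-! ### Entropy conditioned on metadata, for a product law of metadata and library. -/

section Mixture

variable {Ω τ L : Type*} [Fintype Ω] [Fintype τ] [Fintype L] {α β : Type*}

/-- The entropy of a mixture: metadata `T` together with a variable on the library. -/
theorem entropy_mixture {P : Ω → ℝ} {μ : τ → ℝ} {ν : L → ℝ} (e : Ω ≃ τ × L)
    (hP : ∀ ω, P ω = μ (e ω).1 * ν (e ω).2) (hν : ∀ l, 0 ≤ ν l)
    (hν1 : ∑ l, ν l = 1) (X : Ω → α) :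
    entropy P (fun ω => (X ω, (e ω).1)) = entropy P (fun ω => (e ω).1) +
      ∑ t, μ t * entropy ν (fun l => X (e.symm (t, l))) := by
  classical
  have hsum : ∀ f : Ω → ℝ, ∑ ω, f ω = ∑ t, ∑ l, f (e.symm (t, l)) := fun f => by
    rw [← Fintype.sum_prod_type', ← e.symm.sum_comp]
  have hm1 : ∀ t, mass P (fun ω => (e ω).1) t = μ t := fun t => by
    rw [mass, hsum]
    simp only [Equiv.apply_symm_apply, hP]
    rw [Finset.sum_eq_single t]
    · simp [← mul_sum, hν1]
    · intro b _ hb; simp [hb]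
    · simp
  have hm2 : ∀ t x, mass P (fun ω => (X ω, (e ω).1)) (x, t) =
      μ t * mass ν (fun l => X (e.symm (t, l))) x := fun t x => by
    rw [mass, hsum]
    simp only [Equiv.apply_symm_apply, hP, Prod.mk.injEq]
    rw [Finset.sum_eq_single t]
    · simp [mass, mul_sum]
    · intro b _ hb; simp [hb]
    · simp
  simp only [entropy_eq_mass, hm1, hm2]
  rw [hsum, hsum]
  simp only [Equiv.apply_symm_apply, hP]
  simp only [mul_neg, sum_neg_distrib, ← neg_add, ← sum_add_distrib]
  congr 1
  refine sum_congr rfl fun t _ => ?_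
  rw [mul_sum, ← sum_add_distrib]
  refine sum_congr rfl fun l _ => ?_
  rcases eq_or_ne (μ t) 0 with h0 | h0
  · simp [h0]
  rcases eq_or_ne (ν l) 0 with h1 | h1
  · simp [h1]
  rw [Real.logb_mul h0 (mass_pos hν (fun l => X (e.symm (t, l))) h1).ne']
  ring

theorem sum_le_entropy {P : Ω → ℝ} {μ : τ → ℝ} {ν : L → ℝ} (e : Ω ≃ τ × L)
    (hP : ∀ ω, P ω = μ (e ω).1 * ν (e ω).2) (hμ : ∀ t, 0 ≤ μ t) (hν : ∀ l, 0 ≤ ν l)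
    (hμ1 : ∑ t, μ t = 1) (hν1 : ∑ l, ν l = 1) (X : Ω → α) :
    ∑ t, μ t * entropy ν (fun l => X (e.symm (t, l))) ≤ entropy P X := by
  have hP0 : ∀ ω, 0 ≤ P ω := fun ω => by rw [hP]; exact mul_nonneg (hμ _) (hν _)
  have hP1 : ∑ ω, P ω = 1 := by
    rw [← e.symm.sum_comp, Fintype.sum_prod_type]
    simp [hP, ← mul_sum, hν1, hμ1]
  have h := entropy_mixture e hP hν hν1 X
  have h2 := condEntropy_anti hP0 X (Y := fun _ => ()) (Z := fun ω => (e ω).1) fun _ _ _ => rfl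
  rw [condEntropy_const hP1, condEntropy] at h2
  linarith

theorem sum_le_condEntropy {P : Ω → ℝ} {μ : τ → ℝ} {ν : L → ℝ} (e : Ω ≃ τ × L)
    (hP : ∀ ω, P ω = μ (e ω).1 * ν (e ω).2) (hμ : ∀ t, 0 ≤ μ t) (hν : ∀ l, 0 ≤ ν l)
    (hν1 : ∑ l, ν l = 1) (X : Ω → α) (Y : Ω → β) :
    ∑ t, μ t * condEntropy ν (fun l => X (e.symm (t, l))) (fun l => Y (e.symm (t, l))) ≤
      condEntropy P X Y := by
  have hP0 : ∀ ω, 0 ≤ P ω := fun ω => by rw [hP]; exact mul_nonneg (hμ _) (hν _)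
  have h := entropy_mixture e hP hν hν1 Y
  have h' := entropy_mixture e hP hν hν1 (fun ω => (X ω, Y ω))
  have h2 := condEntropy_anti hP0 X (Y := Y) (Z := fun ω => (Y ω, (e ω).1))
    fun _ _ h => (Prod.ext_iff.1 h).1
  have h3 : entropy P (fun ω => (X ω, Y ω, (e ω).1)) =
      entropy P (fun ω => ((X ω, Y ω), (e ω).1)) := entropy_congr fun _ _ => by
    simp [and_assoc]
  refine le_trans (le_of_eq ?_) h2
  simp only [condEntropy, mul_sub, sum_sub_distrib] at h h' h3 ⊢
  rw [h3, h, h']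
  ring

end Mixture

/-! ### Orderings of the demanded files -/

section Order

/-- Every order has exactly one first element of `J`; exchange the two counts. -/
theorem sum_first_perm {n : ℕ} {J : Finset (Fin n)} (hJ : J.Nonempty) :
    ∑ j ∈ J, #{π : Equiv.Perm (Fin n) | ∀ s ∈ J, π j ≤ π s} = n.factorial := by
  classical
  have h : ∀ π : Equiv.Perm (Fin n), #{j ∈ J | ∀ s ∈ J, π j ≤ π s} = 1 := fun π => by
    obtain ⟨j, hj, hmin⟩ := J.exists_min_image π hJ
    rw [card_eq_one]
    refine ⟨j, ?_⟩
    ext i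
    simp only [mem_filter, mem_singleton]
    constructor
    · rintro ⟨hi, h⟩
      exact π.injective (le_antisymm (h j hj) (hmin i hi))
    · rintro rfl
      exact ⟨hj, hmin⟩
  simp only [card_filter] at h ⊢
  rw [sum_comm, sum_congr rfl fun π _ => h π]
  simp [Fintype.card_perm]

/-- Precomposing with the transposition of `j` and `j'` maps the orders with `j` first injectively
to those with `j'` first. -/
theorem card_first_perm_le {n : ℕ} {J : Finset (Fin n)} {j j' : Fin n} (hj : j ∈ J)
    (hj' : j' ∈ J) :
    #{π : Equiv.Perm (Fin n) | ∀ s ∈ J, π j ≤ π s} ≤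
      #{π : Equiv.Perm (Fin n) | ∀ s ∈ J, π j' ≤ π s} := by
  refine card_le_card_of_injOn (fun π => (Equiv.swap j j').trans π) (fun π hπ => ?_)
    fun π _ π' _ h => ?_
  · simp only [coe_filter, mem_univ, true_and, Set.mem_ofPred_eq] at hπ ⊢
    intro s hs
    simp only [Equiv.trans_apply, Equiv.swap_apply_right]
    refine hπ _ ?_
    by_cases h1 : s = j
    · simpa [h1] using hj'
    by_cases h2 : s = j'
    · simpa [h2] using hj
    rwa [Equiv.swap_apply_of_ne_of_ne h1 h2]
  · ext x
    have := congrArg (fun e : Equiv.Perm (Fin n) => e (Equiv.swap j j' x)) h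
    simpa using congrArg Fin.val this

/-- In a uniformly random order, `j` precedes all other elements of `J` with probability
`1 / |J|`. -/
theorem card_mul_card_first_perm {n : ℕ} {J : Finset (Fin n)} {j : Fin n} (hj : j ∈ J) :
    #J * #{π : Equiv.Perm (Fin n) | ∀ s ∈ J, π j ≤ π s} = n.factorial := by
  rw [← sum_first_perm ⟨j, hj⟩, ← smul_eq_mul, ← sum_const]
  exact sum_congr rfl fun i hi =>
    le_antisymm (card_first_perm_le hj hi) (card_first_perm_le hi hj)

/-- Weight of the demanded bits. -/
noncomputable def bitWeight (n h : ℕ) : ℝ := (h + 2 * n) / ((h + 2) * n)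

/-- Weight of the demanded bits that are cached for another demand. -/
noncomputable def overlapWeight (n h : ℕ) : ℝ := (2 * h + n) / ((h + 1) * (h + 2) * n)

theorem bitWeight_nonneg (n h : ℕ) : 0 ≤ bitWeight n h := by
  unfold bitWeight; positivity

theorem overlapWeight_nonneg (n h : ℕ) : 0 ≤ overlapWeight n h := by
  unfold overlapWeight; positivity

/-- A linear minorant of `1 / (x + 1)` on the integers from `0` to `n - 1`. Up to a positive
denominator the gap is `(n-1-x)(x-h)(x-h-1) + (x+1)x(x-1)`, nonnegative because products of two
consecutive integers are. For `h = 0` it is the chord `1 - x / 2`. -/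
theorem weights_le_inv {n h x : ℕ} (hx : x + 1 ≤ n) :
    bitWeight n h - overlapWeight n h * x ≤ 1 / ((x : ℝ) + 1) := by
  have hn : (0 : ℝ) < n := by exact_mod_cast (Nat.succ_pos x).trans_le hx
  have hx' : (x : ℝ) + 1 ≤ n := by exact_mod_cast hx
  have hcons : ∀ a : ℤ, 0 ≤ a * (a - 1) := fun a => by
    rcases le_or_gt a 0 with h | h
    · nlinarith
    · exact mul_nonneg h.le (by lia)
  have h1 : (0 : ℝ) ≤ (x : ℝ) * (x - 1) := by exact_mod_cast hcons x
  have h2 : (0 : ℝ) ≤ ((x : ℝ) - h) * (x - h - 1) := by exact_mod_cast hcons (x - h)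
  rw [bitWeight, overlapWeight, ← sub_nonneg]
  have key : 1 / ((x : ℝ) + 1) - ((h + 2 * n) / ((h + 2) * n) -
      (2 * h + n) / ((h + 1) * (h + 2) * n) * x) =
      ((n - 1 - x) * ((x - h) * (x - h - 1)) + (x + 1) * (x * (x - 1))) /
        ((h + 1) * (h + 2) * n * (x + 1)) := by
    field_simp
    ring
  rw [key]
  have h3 : (0 : ℝ) ≤ n - 1 - x := by linarith
  positivity

end Order

/-! ### Uniform independent bits -/

section Bits

/-- The law of independent fair bits. -/
noncomputable def fair (ι : Type*) [Fintype ι] : (ι → Bool) → ℝ := fun _ => (1 / 2) ^ Fintype.card ι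

/-- The bits with index in `A`. -/
def restr {ι : Type*} (A : Finset ι) (f : ι → Bool) : A → Bool := fun i => f i

theorem restr_eq_iff {ι : Type*} {A : Finset ι} {f g : ι → Bool} :
    restr A f = restr A g ↔ ∀ i ∈ A, f i = g i := by
  simp [funext_iff, restr]

theorem fair_pos {ι : Type*} [Fintype ι] (f : ι → Bool) : 0 < fair ι f := by unfold fair; positivity

theorem fair_nonneg {ι : Type*} [Fintype ι] (f : ι → Bool) : 0 ≤ fair ι f := (fair_pos f).le

theorem card_union_eq {ι : Type*} [DecidableEq ι] (A B : Finset ι) : (#(A ∪ B) : ℝ) = #(A \ B) + #B := by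
  rw [← card_sdiff_add_card A B]
  push_cast
  ring

/-- The orders counted are those in which `j` comes first among `j` itself and the indices `s` with
`b ∈ C s`, a set of one more element because `b ∉ C j`. -/
theorem card_order_eq {ι : Type*} [DecidableEq ι] {n : ℕ} (C : Fin n → Finset ι) {j : Fin n} {b : ι} (hb : b ∉ C j) :
    (#{s | b ∈ C s} + 1) * #{π : Equiv.Perm (Fin n) | ∀ s, π s ≤ π j → b ∉ C s} =
      n.factorial := by
  rw [← card_mul_card_first_perm (J := insert j (univ.filter fun s => b ∈ C s)) (mem_insert_self _ _),
    card_insert_of_notMem (by simpa using hb)]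
  congr 2
  ext π
  simp only [mem_filter, mem_univ, true_and, mem_insert, forall_eq_or_imp, le_refl]
  refine forall_congr' fun s => ?_
  constructor
  · intro h hs
    by_contra hlt
    exact h (not_le.1 hlt).le hs
  · intro h hle hs
    have : s = j := π.injective (le_antisymm hle (h hs))
    exact hb (this ▸ hs)

/-- Pass from `f` to `g` through the hybrid that equals `f` on `A` and `g` elsewhere. -/
theorem dependsOn_inter {ι α : Type*} {V : (ι → Bool) → α} {A B : Set ι} (hA : DependsOn V A)
    (hB : DependsOn V B) : DependsOn V (A ∩ B) := by
  classical
  intro f g h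
  have h1 : V f = V (fun i => if i ∈ A then f i else g i) := hA fun i hi => by simp [hi]
  have h2 : V (fun i => if i ∈ A then f i else g i) = V g := hB fun i hi => by
    by_cases hiA : i ∈ A
    · simpa [hiA] using h i ⟨hiA, hi⟩
    · simp [hiA]
  exact h1.trans h2

variable {ι : Type*} [Fintype ι] [DecidableEq ι] {α β : Type*}

/-- The strings that agree with `g` on `A` form a box, so their total probability factors over the
coordinates. -/
theorem mass_restr (A : Finset ι) (g : ι → Bool) :
    mass (fair ι) (restr A) (restr A g) = (1 / 2) ^ #A := by
  classical
  have h := prod_univ_sum (fun i => if i ∈ A then {g i} else (univ : Finset Bool))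
    (fun _ _ => (1 / 2 : ℝ))
  have h1 : ∀ i, ∑ _b ∈ (if i ∈ A then {g i} else (univ : Finset Bool)), (1 / 2 : ℝ) =
      if i ∈ A then 1 / 2 else 1 := fun i => by
    split_ifs <;> norm_num
  rw [prod_congr rfl fun i _ => h1 i, prod_ite] at h
  simp only [prod_const, one_pow, mul_one, filter_mem_eq_inter, univ_inter] at h
  rw [h, mass, ← univ_inter (Fintype.piFinset _), ← sum_ite_mem]
  refine sum_congr rfl fun f _ => ?_
  have hf : restr A f = restr A g ↔
      f ∈ Fintype.piFinset fun i => if i ∈ A then {g i} else (univ : Finset Bool) := by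
    simp only [Fintype.mem_piFinset, restr_eq_iff]
    refine forall_congr' fun i => ?_
    split_ifs with hi <;> simp [hi]
  simp only [hf]
  split_ifs <;> rfl

theorem sum_fair : ∑ f : ι → Bool, fair ι f = 1 := by
  have h := mass_restr (∅ : Finset ι) fun _ => false
  rw [card_empty, pow_zero] at h
  rw [← h, mass]
  refine sum_congr rfl fun f _ => ?_
  rw [if_pos (Subsingleton.elim _ _)]

theorem entropy_restr (A : Finset ι) : entropy (fair ι) (restr A) = #A := by
  simp only [entropy_eq_mass, mass_restr]
  rw [← sum_mul, sum_fair, Real.logb_pow, one_div, Real.logb_inv, Real.logb_self_eq_one one_lt_two]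
  ring

theorem entropy_restr_pair (A B : Finset ι) :
    entropy (fair ι) (fun f => (restr A f, restr B f)) = #(A ∪ B) := by
  rw [← entropy_restr]
  refine entropy_congr fun f g => ?_
  simp only [Prod.mk.injEq, restr_eq_iff, mem_union]
  exact ⟨fun h i hi => hi.elim (h.1 i) (h.2 i), fun h => ⟨fun i hi => h i (.inl hi),
    fun i hi => h i (.inr hi)⟩⟩

/-- Bits that neither the signal nor the side information depends on cannot be decoded. -/
theorem card_sdiff_le_condEntropy {V : (ι → Bool) → α} {S C F : Finset ι} (hV : DependsOn V S) :
    (#(F \ (S ∪ C)) : ℝ) ≤ condEntropy (fair ι) (restr F) (fun f => (V f, restr C f)) := by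
  have h := condEntropy_anti (P := fair ι) fair_nonneg (restr F)
    (Y := fun f => (V f, restr C f)) (Z := restr (S ∪ C)) fun f g h => by
      rw [restr_eq_iff] at h
      refine Prod.ext (hV fun i hi => h i (mem_union_left _ hi)) ?_
      exact restr_eq_iff.2 fun i hi => h i (mem_union_right _ hi)
  refine le_trans (le_of_eq ?_) h
  rw [condEntropy, entropy_restr_pair, entropy_restr, card_union_eq]
  ring

/-- One step of the chain: with the side information `C`, the bits `F` can be decoded. -/
theorem chain_step (V : (ι → Bool) → α) (W C F : Finset ι) :
    (#(F \ (W ∪ C)) : ℝ) - condEntropy (fair ι) (restr F) (fun f => (V f, restr C f)) +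
      condEntropy (fair ι) V (restr (W ∪ C ∪ F)) ≤ condEntropy (fair ι) V (restr W) := by
  have h1 := condEntropy_anti (P := fair ι) fair_nonneg V (Y := restr W) (Z := restr (W ∪ C))
    fun f g h => by
      rw [restr_eq_iff] at h ⊢
      exact fun i hi => h i (mem_union_left _ hi)
  have h2 := condEntropy_anti (P := fair ι) fair_nonneg (restr F)
    (Y := fun f => (V f, restr C f)) (Z := fun f => (V f, restr (W ∪ C) f)) fun f g h => by
      simp only [Prod.mk.injEq, restr_eq_iff] at h ⊢
      exact ⟨h.1, fun i hi => h.2 i (mem_union_right _ hi)⟩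
  have h3 : entropy (fair ι) (fun f => (restr F f, V f, restr (W ∪ C) f)) =
      entropy (fair ι) (fun f => (V f, restr (W ∪ C ∪ F) f)) := entropy_congr fun f g => by
    simp only [Prod.mk.injEq, restr_eq_iff, mem_union]
    grind
  have h4 := card_union_eq F (W ∪ C)
  rw [union_comm F] at h4
  simp only [condEntropy] at h1 h2 h3 ⊢
  rw [entropy_restr] at h1 ⊢
  rw [entropy_restr] at h1 ⊢
  linarith

/-- A signal from which, with the side information `C j`, the bits `F j` can be decoded for
each `j`. The demands are treated in the order `π`. -/
theorem entropy_ge_chain {n : ℕ} (V : (ι → Bool) → α) (C F : Fin n → Finset ι)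
    (hF : Pairwise fun i j => Disjoint (F i) (F j)) (π : Equiv.Perm (Fin n)) :
    ∑ j, ((#{b ∈ F j | ∀ s, π s ≤ π j → b ∉ C s} : ℝ) -
      condEntropy (fair ι) (restr (F j)) (fun f => (V f, restr (C j) f))) ≤
        entropy (fair ι) V := by
  classical
  set w : Fin n → ℝ := fun j => (#{b ∈ F j | ∀ s, π s ≤ π j → b ∉ C s} : ℝ) -
      condEntropy (fair ι) (restr (F j)) (fun f => (V f, restr (C j) f)) with hw
  -- Induction on the number of blocks treated; the conditioning contains the caches and files of
  -- the first `t` blocks in the order `π`.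
  have key : ∀ t ≤ n, ∑ j with (π j : ℕ) < t, w j + condEntropy (fair ι) V
      (restr ((univ.filter fun j => (π j : ℕ) < t).biUnion fun s => C s ∪ F s)) ≤
        entropy (fair ι) V := by
    intro t
    induction t with
    | zero =>
      intro _
      have h0 : (univ.filter fun j => (π j : ℕ) < 0) = ∅ := by simp
      rw [h0, sum_empty, biUnion_empty, zero_add]
      rw [condEntropy, entropy_restr, card_empty, Nat.cast_zero, sub_zero]
      refine (entropy_congr fun f g => ?_).le
      simp [restr_eq_iff]
    | succ t ih =>
      intro ht
      refine le_trans ?_ (ih (by lia))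
      set j := π.symm ⟨t, ht⟩ with hj
      have hπj : π j = ⟨t, ht⟩ := by simp [hj]
      have hins : (univ.filter fun i => (π i : ℕ) < t + 1) =
          insert j (univ.filter fun i => (π i : ℕ) < t) := by
        ext i
        simp only [mem_filter, mem_univ, true_and, mem_insert, hj, Equiv.eq_symm_apply, Fin.ext_iff]
        lia
      have hnot : j ∉ univ.filter fun i => (π i : ℕ) < t := by simp [hπj]
      rw [hins, sum_insert hnot, biUnion_insert]
      set W := (univ.filter fun j => (π j : ℕ) < t).biUnion fun s => C s ∪ F s with hW
      have hstep := chain_step V W (C j) (F j)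
      rw [union_comm (C j ∪ F j), ← union_assoc]
      -- The conditioning also contains the earlier files `F s`, but these are disjoint from `F j`,
      -- so only the caches can remove bits.
      have hsub : #{b ∈ F j | ∀ s, π s ≤ π j → b ∉ C s} ≤ #(F j \ (W ∪ C j)) := by
        refine card_le_card fun b hb => ?_
        simp only [mem_filter] at hb
        simp only [mem_sdiff, mem_union, hW, mem_biUnion, mem_filter, mem_univ, true_and, not_or,
          not_exists, not_and]
        refine ⟨hb.1, fun s hs => ⟨hb.2 s ?_, fun hbs => ?_⟩, hb.2 j le_rfl⟩
        · rw [hπj, Fin.le_def]; exact hs.le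
        · refine disjoint_left.1 (hF (?_ : s ≠ j)) hbs hb.1
          rintro rfl
          simp [hπj] at hs
      have hsub' : (#{b ∈ F j | ∀ s, π s ≤ π j → b ∉ C s} : ℝ) ≤ #(F j \ (W ∪ C j)) := by
        exact_mod_cast hsub
      simp only [hw] at hstep ⊢
      linarith
  have h := key n le_rfl
  rw [filter_true_of_mem fun j _ => (π j).2] at h
  have h0 := condEntropy_nonneg (P := fair ι) fair_nonneg V
    (restr ((univ : Finset (Fin n)).biUnion fun s => C s ∪ F s))
  linarith

/-- The chain bound, averaged over all orders of the demands. -/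
theorem entropy_ge_average {n : ℕ} (h : ℕ) (V : (ι → Bool) → α) (C F : Fin n → Finset ι)
    (hF : Pairwise fun i j => Disjoint (F i) (F j)) :
    ∑ j, (bitWeight n h * #(F j \ C j) - overlapWeight n h * ∑ i, (#((F j \ C j) ∩ C i) : ℝ) -
      condEntropy (fair ι) (restr (F j)) (fun f => (V f, restr (C j) f))) ≤
        entropy (fair ι) V := by
  classical
  set δ : Fin n → ℝ := fun j =>
    condEntropy (fair ι) (restr (F j)) (fun f => (V f, restr (C j) f)) with hδ
  have hsum : ∑ π : Equiv.Perm (Fin n), ∑ j,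
      ((#{b ∈ F j | ∀ s, π s ≤ π j → b ∉ C s} : ℝ) - δ j) ≤
        n.factorial * entropy (fair ι) V := by
    refine (sum_le_sum fun π _ => entropy_ge_chain V C F hF π).trans_eq ?_
    simp [Fintype.card_perm]
  have hfac : (0 : ℝ) < n.factorial := by exact_mod_cast n.factorial_pos
  refine le_of_mul_le_mul_left (le_trans ?_ hsum) hfac
  rw [sum_comm, mul_sum]
  refine sum_le_sum fun j _ => ?_
  rw [sum_sub_distrib, mul_sub]
  refine sub_le_sub ?_ (by simp [Fintype.card_perm, hδ])
  have h1 : ∑ π : Equiv.Perm (Fin n), (#{b ∈ F j | ∀ s, π s ≤ π j → b ∉ C s} : ℝ) =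
      ∑ b ∈ F j, (#{π : Equiv.Perm (Fin n) | ∀ s, π s ≤ π j → b ∉ C s} : ℝ) := by
    simp only [card_filter]
    push_cast
    rw [sum_comm]
  have h2 : ∑ i, (#((F j \ C j) ∩ C i) : ℝ) = ∑ b ∈ F j \ C j, (#{s | b ∈ C s} : ℝ) := by
    simp only [← filter_mem_eq_inter, card_filter]
    push_cast
    rw [sum_comm]
  rw [h1, h2]
  calc (n.factorial : ℝ) * (bitWeight n h * #(F j \ C j) -
        overlapWeight n h * ∑ b ∈ F j \ C j, (#{s | b ∈ C s} : ℝ))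
      = ∑ b ∈ F j \ C j, n.factorial * (bitWeight n h - overlapWeight n h * #{s | b ∈ C s}) := by
        rw [← mul_sum, sum_sub_distrib, mul_sum]
        simp [mul_comm]
    _ ≤ ∑ b ∈ F j \ C j, (#{π : Equiv.Perm (Fin n) | ∀ s, π s ≤ π j → b ∉ C s} : ℝ) := by
        refine sum_le_sum fun b hb => ?_
        have hbC : b ∉ C j := (mem_sdiff.1 hb).2
        have hc := card_order_eq C hbC
        have hx : #{s | b ∈ C s} + 1 ≤ n := by
          have : (univ.filter fun s => b ∈ C s) ⊆ univ.erase j := fun s hs => by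
            simp only [mem_filter, mem_univ, true_and] at hs
            simp only [mem_erase, mem_univ, and_true]
            rintro rfl
            exact hbC hs
          have h' := card_le_card this
          rw [card_erase_of_mem (mem_univ _), card_univ, Fintype.card_fin] at h'
          have := j.pos
          lia
        have hw := weights_le_inv (h := h) hx
        rw [← hc]
        push_cast
        have hp : (0 : ℝ) < #{s | b ∈ C s} + 1 := by positivity
        calc _ ≤ ((#{s | b ∈ C s} : ℝ) + 1) *
              #{π : Equiv.Perm (Fin n) | ∀ s, π s ≤ π j → b ∉ C s} *
              (1 / (#{s | b ∈ C s} + 1)) :=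
              mul_le_mul_of_nonneg_left hw (by positivity)
          _ = _ := by field_simp
    _ ≤ _ := sum_le_sum_of_subset_of_nonneg sdiff_subset fun _ _ _ => by positivity

theorem dependsOn_forall {n : ℕ} {V : (ι → Bool) → α} {A : Fin n → Finset ι}
    (hA : ∀ j, DependsOn V (A j)) :
    DependsOn V ((univ.filter fun i => ∀ j, i ∈ A j : Finset ι) : Set ι) := by
  have key : ∀ J : Finset (Fin n), DependsOn V {i | ∀ j ∈ J, i ∈ A j} := fun J => by
    induction J using Finset.induction_on with
    | empty => simpa using dependsOn_univ V
    | insert a J _ ih =>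
      refine (dependsOn_inter (hA a) ih).mono fun i hi => ?_
      simp only [mem_insert, forall_eq_or_imp, Set.mem_ofPred_eq]
      exact hi
  exact (key univ).mono fun i hi => by simpa using hi

/-- The converse for two transmitters whose caches are `A j` and `C j` when both demand `F j`. -/
theorem two_transmitter_converse {n : ℕ} (h : ℕ) {V₁ : (ι → Bool) → α} {V₂ : (ι → Bool) → β}
    {A C F : Fin n → Finset ι} (hF : Pairwise fun i j => Disjoint (F i) (F j))
    (hA : ∀ j, DependsOn V₁ (A j)) (hC : ∀ j, DependsOn V₂ (C j)) :
    ∑ i, (bitWeight n h * (#(F i) - #(F i ∩ (A i ∩ C i))) -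
      overlapWeight n h * ∑ j ∈ univ.erase i, (#(F j ∩ (A i ∩ C i)) : ℝ) -
      (1 + overlapWeight n h * n) *
        (condEntropy (fair ι) (restr (F i)) (fun f => (V₁ f, restr (C i) f)) +
          condEntropy (fair ι) (restr (F i)) (fun f => (V₂ f, restr (A i) f)))) ≤
      entropy (fair ι) V₁ + entropy (fair ι) V₂ := by
  classical
  have hn1 := entropy_ge_average h V₁ C F hF
  have hn2 := entropy_ge_average h V₂ A F hF
  refine le_trans ?_ (add_le_add hn1 hn2)
  set δ₁ : Fin n → ℝ := fun j =>
    condEntropy (fair ι) (restr (F j)) (fun f => (V₁ f, restr (C j) f))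
  set δ₂ : Fin n → ℝ := fun j =>
    condEntropy (fair ι) (restr (F j)) (fun f => (V₂ f, restr (A j) f))
  set S₁ : Finset ι := univ.filter fun i => ∀ j, i ∈ A j with hS₁
  set S₂ : Finset ι := univ.filter fun i => ∀ j, i ∈ C j with hS₂
  have hd1 : ∀ j, (#(F j \ (S₁ ∪ C j)) : ℝ) ≤ δ₁ j := fun j =>
    card_sdiff_le_condEntropy (dependsOn_forall hA)
  have hd2 : ∀ j, (#(F j \ (S₂ ∪ A j)) : ℝ) ≤ δ₂ j := fun j =>
    card_sdiff_le_condEntropy (dependsOn_forall hC)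
  have hn01 : ∀ j, 0 ≤ δ₁ j := fun j => (Nat.cast_nonneg _).trans (hd1 j)
  have hn02 : ∀ j, 0 ≤ δ₂ j := fun j => (Nat.cast_nonneg _).trans (hd2 j)
  have hcard : ∀ j, (#(F j) : ℝ) - #(F j ∩ (A j ∩ C j)) ≤ #(F j \ C j) + #(F j \ A j) := by
    intro j
    have : F j ⊆ F j ∩ (A j ∩ C j) ∪ (F j \ C j ∪ F j \ A j) := fun b hb => by
      simp only [mem_union, mem_inter, mem_sdiff, hb, true_and]
      tauto
    have h' := (card_le_card this).trans
      ((card_union_le _ _).trans (Nat.add_le_add_left (card_union_le _ _) _))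
    have h'' : (#(F j) : ℝ) ≤ #(F j ∩ (A j ∩ C j)) + (#(F j \ C j) + #(F j \ A j)) := by
      exact_mod_cast h'
    linarith
  -- Up to undecodable bits, `F j \ C j` lies in `S₁` and `F j \ A j` in `S₂`. The first set avoids
  -- `S₂`, so the two overlaps occupy complementary parts of `F j ∩ (A i ∩ C i)` and together cost
  -- at most one copy of it.
  have hcross : ∀ j i, (#((F j \ C j) ∩ C i) : ℝ) + #((F j \ A j) ∩ A i) ≤
      (if i = j then 0 else (#(F j ∩ (A i ∩ C i)) : ℝ)) + (δ₁ j + δ₂ j) := by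
    intro j i
    split_ifs with hij
    · subst hij
      have e1 : (F i \ C i) ∩ C i = ∅ := by ext b; simp
      have e2 : (F i \ A i) ∩ A i = ∅ := by ext b; simp
      rw [e1, e2]
      have := hn01 i
      have := hn02 i
      simp only [card_empty, Nat.cast_zero]
      linarith
    · have s1 : (F j \ C j) ∩ C i ⊆ ((F j ∩ (A i ∩ C i)) \ S₂) ∪ F j \ (S₁ ∪ C j) := by
        intro b hb
        simp only [mem_inter, mem_sdiff, mem_union, hS₁, hS₂, mem_filter, mem_univ,
          true_and] at hb ⊢
        by_cases hb1 : ∀ j, b ∈ A j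
        · exact .inl ⟨⟨hb.1.1, hb1 i, hb.2⟩, fun h2 => hb.1.2 (h2 j)⟩
        · exact .inr ⟨hb.1.1, not_or.2 ⟨hb1, hb.1.2⟩⟩
      have s2 : (F j \ A j) ∩ A i ⊆ ((F j ∩ (A i ∩ C i)) ∩ S₂) ∪ F j \ (S₂ ∪ A j) := by
        intro b hb
        simp only [mem_inter, mem_sdiff, mem_union, hS₂, mem_filter, mem_univ,
          true_and] at hb ⊢
        by_cases hb1 : ∀ j, b ∈ C j
        · exact .inl ⟨⟨hb.1.1, hb.2, hb1 i⟩, hb1⟩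
        · exact .inr ⟨hb.1.1, not_or.2 ⟨hb1, hb.1.2⟩⟩
      have c1 := (card_le_card s1).trans (card_union_le _ _)
      have c2 := (card_le_card s2).trans (card_union_le _ _)
      have c3 := card_sdiff_add_card_inter (F j ∩ (A i ∩ C i)) S₂
      have c1' : (#((F j \ C j) ∩ C i) : ℝ) ≤
        #((F j ∩ (A i ∩ C i)) \ S₂) + #(F j \ (S₁ ∪ C j)) := by exact_mod_cast c1
      have c2' : (#((F j \ A j) ∩ A i) : ℝ) ≤
        #((F j ∩ (A i ∩ C i)) ∩ S₂) + #(F j \ (S₂ ∪ A j)) := by exact_mod_cast c2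
      have c3' : (#((F j ∩ (A i ∩ C i)) \ S₂) : ℝ) + #((F j ∩ (A i ∩ C i)) ∩ S₂) =
        #(F j ∩ (A i ∩ C i)) := by exact_mod_cast c3
      have := hd1 j
      have := hd2 j
      linarith
  have hb := bitWeight_nonneg n h
  have ho := overlapWeight_nonneg n h
  -- Regroup the overlaps by the index of the caches instead of the index of the file block, so that
  -- each summand depends on one cache realization.
  have hswap : ∑ i, ∑ j ∈ univ.erase i, (#(F j ∩ (A i ∩ C i)) : ℝ) =
      ∑ j, ∑ i, if i = j then 0 else (#(F j ∩ (A i ∩ C i)) : ℝ) := by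
    rw [sum_comm (f := fun j i => if i = j then 0 else (#(F j ∩ (A i ∩ C i)) : ℝ))]
    refine sum_congr rfl fun i _ => ?_
    rw [← add_sum_erase univ _ (mem_univ i), if_pos rfl, zero_add]
    exact sum_congr rfl fun j hj => by rw [if_neg (ne_of_mem_erase hj).symm]
  rw [← sum_add_distrib]
  rw [sum_sub_distrib, sum_sub_distrib, ← mul_sum (a := overlapWeight n h), hswap, mul_sum,
    ← sum_sub_distrib, ← sum_sub_distrib]
  refine sum_le_sum fun j _ => ?_
  have hx := sum_le_sum fun i (_ : i ∈ univ) => hcross j i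
  rw [sum_add_distrib, sum_add_distrib, sum_const, card_univ, Fintype.card_fin,
    nsmul_eq_mul] at hx
  have hy := mul_le_mul_of_nonneg_left hx ho
  have hz := mul_le_mul_of_nonneg_left (hcard j) hb
  simp only [mul_add, mul_sub, add_mul, one_mul] at hy hz ⊢
  linarith

end Bits

/-! ### Averaging -/

section Averaging

theorem sum_toReal_pmf {α : Type*} [Fintype α] (p : PMF α) : ∑ a, (p a).toReal = 1 := by
  rw [← ENNReal.toReal_sum fun a _ => p.apply_ne_top a, ← tsum_fintype (L := .unconditional _),
    p.tsum_coe, ENNReal.toReal_one]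

theorem exists_ge_average {Z : Type*} [Fintype Z] {w f : Z → ℝ} {r : ℝ} (hw : ∀ z, 0 ≤ w z)
    (hr : 0 < r) (hsum : ∑ z, w z = r) : ∃ z, w z ≠ 0 ∧ ∑ z, w z * f z ≤ r * f z := by
  by_contra! hcon
  obtain ⟨z₀, -, hz₀⟩ := exists_ne_zero_of_sum_ne_zero (hsum.trans_ne hr.ne')
  set E := ∑ z, w z * f z with hE
  have h1 : ∑ z, w z * (r * f z) < ∑ z, w z * E := by
    refine sum_lt_sum (fun z _ => ?_) ⟨z₀, mem_univ _, ?_⟩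
    · rcases eq_or_ne (w z) 0 with h | h
      · simp [h]
      · exact mul_le_mul_of_nonneg_left (hcon z h).le (hw z)
    · exact mul_lt_mul_of_pos_left (hcon z₀ hz₀) ((hw z₀).lt_of_ne' hz₀)
  have h2 : ∑ z, w z * (r * f z) = r * E := by
    rw [hE, mul_sum]
    exact sum_congr rfl fun z _ => by ring
  rw [h2, ← sum_mul, hsum] at h1
  exact lt_irrefl _ h1

/-- A bound that is a sum of functions of separate variables, valid on the supports, may be
averaged in every variable. -/
theorem sum_average_le {J Z : Type*} [Fintype J] [Fintype Z] {w f : J → Z → ℝ} {r H : ℝ}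
    (hw : ∀ j z, 0 ≤ w j z) (hr : 0 ≤ r) (hsum : ∀ j, ∑ z, w j z = r)
    (h : ∀ z : J → Z, (∀ j, w j (z j) ≠ 0) → ∑ j, f j (z j) ≤ H) :
    ∑ j, ∑ z, w j z * f j z ≤ r * H := by
  rcases hr.eq_or_lt with h0 | hpos
  · have hz : ∀ j z, w j z = 0 := fun j z =>
      (sum_eq_zero_iff_of_nonneg fun z _ => hw j z).1 ((hsum j).trans h0.symm) z (mem_univ z)
    simp [hz, ← h0]
  -- In each variable separately, choose a point of the support that does at least as well as the
  -- average; the hypothesis then applies to the resulting tuple. No joint law of the variables is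
  -- needed.
  · choose z hz hle using fun j => exists_ge_average (f := f j) (hw j) hpos (hsum j)
    calc ∑ j, ∑ z, w j z * f j z ≤ ∑ j, r * f j (z j) := sum_le_sum fun j _ => hle j
      _ = r * ∑ j, f j (z j) := (mul_sum _ _ _).symm
      _ ≤ r * H := mul_le_mul_of_nonneg_left (h z hz) hr

end Averaging

/-! ### The constraints on a scheme, read for fixed demands and metadata. -/

namespace Scheme

variable {K N B : ℕ} (s : Scheme K N B) {PD : PMF (Demand K N)}

/-- Demands and metadata. -/
abbrev Metadata : Type := Demand K N × (∀ k, s.CacheMeta k) × (∀ k, s.PacketMeta k)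

/-- An outcome consists of demands, metadata and the bits of the library. -/
def outcomeEquiv : s.Outcome ≃ s.Metadata × (Fin N × Fin B → Bool) where
  toFun ω := ((ω.1, ω.2.2.1, ω.2.2.2), Function.uncurry ω.2.1)
  invFun t := (t.1.1, Function.curry t.2, t.1.2.1, t.1.2.2)
  left_inv _ := rfl
  right_inv _ := rfl

/-- The joint law of cache and packet metadata, given the demands. -/
noncomputable def metaLaw (d : Demand K N) (z : ∀ k, s.CacheMeta k) (p : ∀ k, s.PacketMeta k) : ℝ :=
  (s.placement z).toReal * (s.delivery d z p).toReal

theorem metaLaw_nonneg (d : Demand K N) (z : ∀ k, s.CacheMeta k) (p : ∀ k, s.PacketMeta k) :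
    0 ≤ s.metaLaw d z p := mul_nonneg ENNReal.toReal_nonneg ENNReal.toReal_nonneg

theorem sum_metaLaw (d : Demand K N) (z : ∀ k, s.CacheMeta k) :
    ∑ p, s.metaLaw d z p = (s.placement z).toReal := by
  simp only [metaLaw, ← mul_sum, sum_toReal_pmf, mul_one]

/-- The law of demands and metadata. -/
noncomputable def fullLaw (PD : PMF (Demand K N)) (t : s.Metadata) : ℝ :=
  (PD t.1).toReal * s.metaLaw t.1 t.2.1 t.2.2

theorem fullLaw_nonneg (t : s.Metadata) : 0 ≤ s.fullLaw PD t :=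
  mul_nonneg ENNReal.toReal_nonneg (s.metaLaw_nonneg _ _ _)

theorem sum_fullLaw_mul (f : Demand K N → (∀ k, s.CacheMeta k) → (∀ k, s.PacketMeta k) → ℝ) :
    ∑ t : s.Metadata, s.fullLaw PD t * f t.1 t.2.1 t.2.2 =
      ∑ d, (PD d).toReal * ∑ z, ∑ p, s.metaLaw d z p * f d z p := by
  simp only [Fintype.sum_prod_type, fullLaw, mul_assoc, mul_sum]

theorem sum_fullLaw : ∑ t, s.fullLaw PD t = 1 := by
  have h := s.sum_fullLaw_mul (PD := PD) fun _ _ _ => 1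
  simp only [mul_one, sum_metaLaw, sum_toReal_pmf] at h
  exact h

theorem prob_eq (ω : s.Outcome) : s.prob PD ω =
    s.fullLaw PD (s.outcomeEquiv ω).1 * fair (Fin N × Fin B) (s.outcomeEquiv ω).2 := by
  have h : s.outcomeEquiv ω = ((ω.1, ω.2.2.1, ω.2.2.2), Function.uncurry ω.2.1) := rfl
  simp only [h, prob, fullLaw, metaLaw, fair, Fintype.card_prod, Fintype.card_fin]
  ring

theorem prob_nonneg (ω : s.Outcome) : 0 ≤ s.prob PD ω := by
  rw [prob_eq]
  exact mul_nonneg (s.fullLaw_nonneg _) (fair_nonneg _)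

/-- The payload of user `k` as a function of the bits of the library. -/
def payloadBits (k : Fin K) (p : ∀ k, s.PacketMeta k) (f : Fin N × Fin B → Bool) : List Bool :=
  s.payload k (p k) (Function.curry f)

/-- The bits that each user caches. -/
def IsCacheMap (bits : ∀ k, s.CacheMeta k → Finset (Fin N × Fin B)) : Prop :=
  ∀ k c f g, s.content k c (Function.curry f) = s.content k c (Function.curry g) ↔
    restr (bits k c) f = restr (bits k c) g

theorem IsUncoded.exists_cacheMap {s : Scheme K N B} (hs : s.IsUncoded) :
    ∃ bits, s.IsCacheMap bits := by
  choose pos hpos using hs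
  refine ⟨fun k c => (pos k c).toFinset, fun k c f g => ?_⟩
  rw [hpos, hpos, restr_eq_iff, List.map_inj_left]
  simp [Function.curry]

variable {s} {bits : ∀ k, s.CacheMeta k → Finset (Fin N × Fin B)}

/-- Given the metadata, the entropy of the cache is the number of distinct bits copied; conditioning
on the metadata does not increase entropy. -/
theorem CacheSize.sum_card_le {M ε : ℝ} (h : s.CacheSize PD M ε) (hbits : s.IsCacheMap bits)
    (k : Fin K) : ∑ z, (s.placement z).toReal * (#(bits k (z k)) : ℝ) ≤ B * (M + ε) := by
  refine le_trans (le_of_eq ?_) ((sum_le_entropy s.outcomeEquiv s.prob_eq s.fullLaw_nonneg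
    fair_nonneg s.sum_fullLaw sum_fair (s.Z k)).trans (h k))
  have he : ∀ t : s.Metadata, entropy (fair (Fin N × Fin B))
      (fun l => s.Z k (s.outcomeEquiv.symm (t, l))) = #(bits k (t.2.1 k)) := fun t => by
    rw [← entropy_restr]
    refine entropy_congr fun f g => ?_
    rw [← hbits]
    simp [Z, outcomeEquiv]
  simp only [he]
  rw [s.sum_fullLaw_mul fun _ z _ => (#(bits k (z k)) : ℝ)]
  simp only [← sum_mul, sum_metaLaw, sum_toReal_pmf, one_mul]

theorem Load.sum_entropy_le {R ε : ℝ} (h : s.Load PD R ε) {ρ : (∀ k, s.PacketMeta k) → ℝ}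
    (hρ : ∀ d p, ∑ z, s.metaLaw d z p = ρ p) :
    ∑ p, ρ p * ∑ k, entropy (fair (Fin N × Fin B)) (s.payloadBits k p) ≤ B * (R + ε) := by
  refine le_trans (le_of_eq ?_) ((sum_le_sum fun k _ => sum_le_entropy s.outcomeEquiv s.prob_eq
    s.fullLaw_nonneg fair_nonneg s.sum_fullLaw sum_fair (s.X k)).trans h)
  have he : ∀ k, ∀ t : s.Metadata, entropy (fair (Fin N × Fin B))
      (fun l => s.X k (s.outcomeEquiv.symm (t, l))) =
        entropy (fair (Fin N × Fin B)) (s.payloadBits k t.2.2) := fun k t =>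
    entropy_congr fun f g => by simp [X, outcomeEquiv, payloadBits]
  simp only [he]
  rw [sum_comm]
  simp only [← mul_sum]
  rw [s.sum_fullLaw_mul fun _ _ p => ∑ k, entropy (fair (Fin N × Fin B)) (s.payloadBits k p)]
  have h2 : ∀ d, ∑ z, ∑ p, s.metaLaw d z p *
      ∑ k, entropy (fair (Fin N × Fin B)) (s.payloadBits k p) =
      ∑ p, ρ p * ∑ k, entropy (fair (Fin N × Fin B)) (s.payloadBits k p) := fun d => by
    rw [sum_comm]
    simp only [← sum_mul, hρ]
  simp only [h2, ← sum_mul, sum_toReal_pmf, one_mul]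

/-- A zero average of nonnegative conditional entropies vanishes at all metadata of positive
probability. Every library has positive probability, so the dependence holds without exceptions. -/
theorem Encoding.dependsOn (h : s.Encoding PD) (hPD : ∀ d, PD d ≠ 0) (hbits : s.IsCacheMap bits)
    {d : Demand K N} {z : ∀ k, s.CacheMeta k} {p : ∀ k, s.PacketMeta k}
    (hw : s.metaLaw d z p ≠ 0) (k : Fin K) :
    DependsOn (s.payloadBits k p) (bits k (z k) : Set (Fin N × Fin B)) := by
  set φ : s.Metadata → ℝ := fun t => condEntropy (fair (Fin N × Fin B))
    (fun l => s.X k (s.outcomeEquiv.symm (t, l)))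
    (fun l => (s.packetMeta k (s.outcomeEquiv.symm (t, l)), s.Z k (s.outcomeEquiv.symm (t, l))))
    with hφ
  have h1 : ∑ t, s.fullLaw PD t * φ t ≤ 0 :=
    (sum_le_condEntropy s.outcomeEquiv s.prob_eq s.fullLaw_nonneg fair_nonneg sum_fair
      (s.X k) (fun ω => (s.packetMeta k ω, s.Z k ω))).trans_eq (h k)
  have hnn : ∀ t ∈ univ, 0 ≤ s.fullLaw PD t * φ t := fun t _ =>
    mul_nonneg (s.fullLaw_nonneg t) (condEntropy_nonneg fair_nonneg _ _)
  have h2 := (sum_eq_zero_iff_of_nonneg hnn).1 (le_antisymm h1 (sum_nonneg hnn)) (d, z, p)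
    (mem_univ _)
  have hne : s.fullLaw PD (d, z, p) ≠ 0 :=
    mul_ne_zero (ENNReal.toReal_ne_zero.2 ⟨hPD d, PD.apply_ne_top d⟩) hw
  have h3 := (mul_eq_zero.1 h2).resolve_left hne
  intro f g hfg
  have h4 := eq_of_condEntropy_eq_zero fair_pos h3 (ω := g) (ω' := f) (by
    have := (hbits k (z k) f g).2 (restr_eq_iff.2 fun i hi => hfg i hi)
    simp [packetMeta, Z, outcomeEquiv, this])
  simpa [X, outcomeEquiv, payloadBits] using h4

/-- The bits of file `n`. -/
def fileBits (B : ℕ) (n : Fin N) : Finset (Fin N × Fin B) := univ.filter fun i => i.1 = n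

/-- The uncertainty of user `k` about its demanded file, for fixed demands and metadata. -/
noncomputable def userError (s : Scheme K N B)
    (bits : ∀ k, s.CacheMeta k → Finset (Fin N × Fin B)) (d : Demand K N)
    (z : ∀ k, s.CacheMeta k) (p : ∀ k, s.PacketMeta k) (k : Fin K) : ℝ :=
  condEntropy (fair (Fin N × Fin B)) (restr (fileBits B (d k)))
    (fun f => ((fun j => s.payloadBits j p f), restr (bits k (z k)) f))

theorem userError_nonneg (d : Demand K N) (z : ∀ k, s.CacheMeta k) (p : ∀ k, s.PacketMeta k)
    (k : Fin K) : 0 ≤ s.userError bits d z p k := condEntropy_nonneg fair_nonneg _ _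

/-- Fixing the demand vector `d`, an event of probability `PD d`, inflates the average error by at
most the inverse of that probability. -/
theorem Decoding.sum_userError_le {ε : ℝ} (h : s.Decoding PD ε) (hbits : s.IsCacheMap bits)
    (hPD : ∀ d, PD d ≠ 0) (d : Demand K N) :
    ∑ z, ∑ p, s.metaLaw d z p * ∑ k, s.userError bits d z p k ≤
      K * (B * ε) * (PD d).toReal⁻¹ := by
  have hk : ∀ k, ∑ z, ∑ p, s.metaLaw d z p * s.userError bits d z p k ≤
      B * ε * (PD d).toReal⁻¹ := by
    intro k
    have h1 := (sum_le_condEntropy s.outcomeEquiv s.prob_eq s.fullLaw_nonneg fair_nonneg sum_fair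
      (fun ω => s.F (s.D ω k) ω) (fun ω => (s.allX ω, s.Z k ω, s.D ω k))).trans (h k)
    have he : ∀ t : s.Metadata, condEntropy (fair (Fin N × Fin B))
        (fun l => s.F (s.D (s.outcomeEquiv.symm (t, l)) k) (s.outcomeEquiv.symm (t, l)))
        (fun l => (s.allX (s.outcomeEquiv.symm (t, l)), s.Z k (s.outcomeEquiv.symm (t, l)),
          s.D (s.outcomeEquiv.symm (t, l)) k)) = s.userError bits t.1 t.2.1 t.2.2 k := fun t => by
      refine condEntropy_congr (fun f g => ?_) fun f g _ => ?_
      · rw [Prod.mk.injEq (fun j => s.payloadBits j t.2.2 g), ← hbits]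
        simp [allX, X, Z, D, outcomeEquiv, funext_iff, payloadBits]
      · simp only [F, D, outcomeEquiv, restr_eq_iff, fileBits, mem_filter, mem_univ, true_and,
          Prod.forall]
        rw [funext_iff]
        exact ⟨fun h a b e => e ▸ h b, fun h x => h _ _ rfl⟩
    simp only [he] at h1
    rw [s.sum_fullLaw_mul fun d z p => s.userError bits d z p k] at h1
    have hpos : 0 < (PD d).toReal := ENNReal.toReal_pos (hPD d) (PD.apply_ne_top d)
    rw [← div_eq_mul_inv, le_div_iff₀ hpos, mul_comm]
    refine le_trans ?_ h1
    refine single_le_sum (f := fun d => (PD d).toReal *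
      ∑ z, ∑ p, s.metaLaw d z p * s.userError bits d z p k) (fun d _ => ?_) (mem_univ d)
    exact mul_nonneg ENNReal.toReal_nonneg (sum_nonneg fun z _ => sum_nonneg fun p _ =>
      mul_nonneg (s.metaLaw_nonneg _ _ _) (userError_nonneg _ _ _ _))
  have h2 := sum_le_sum fun k (_ : k ∈ univ) => hk k
  rw [sum_const, card_univ, Fintype.card_fin, nsmul_eq_mul, ← mul_assoc (K : ℝ)] at h2
  refine le_trans (le_of_eq ?_) h2
  simp only [mul_sum]
  rw [sum_comm' (t' := univ) (s' := fun _ => univ) (by simp)]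
  conv_rhs => rw [sum_comm' (t' := univ) (s' := fun _ => univ) (by simp)]
  rw [sum_comm]
  refine sum_congr rfl fun z _ => ?_
  rw [sum_comm]

theorem mass_demand (d : Demand K N) : mass (s.prob PD) s.D d = (PD d).toReal := by
  classical
  rw [mass, Fintype.sum_prod_type, sum_eq_single d]
  · simp only [D, if_true, Fintype.sum_prod_type, prob, mul_assoc, ← mul_sum, sum_toReal_pmf,
      mul_one]
    simp only [sum_const, card_univ, Fintype.card_fun, Fintype.card_bool, Fintype.card_fin,
      nsmul_eq_mul, ← pow_mul, Nat.cast_pow, Nat.cast_ofNat]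
    have hpow : (1 / 2 : ℝ) ^ (N * B) * 2 ^ (N * B) = 1 := by rw [← mul_pow]; norm_num
    rw [mul_comm B N, mul_one, hpow, mul_one]
  · intro d' _ hd'
    simp [D, hd']
  · simp

theorem mass_demand_packetMeta (d : Demand K N) (p : ∀ k, s.PacketMeta k) :
    mass (s.prob PD) (fun ω => (s.D ω, ω.2.2.2)) (d, p) =
      (PD d).toReal * ∑ z, s.metaLaw d z p := by
  classical
  rw [mass, Fintype.sum_prod_type, sum_eq_single d]
  · simp only [D, Fintype.sum_prod_type, prob, metaLaw, mul_assoc, Prod.mk.injEq, true_and,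
      sum_ite_eq', mem_univ, if_true, ← mul_sum]
    simp only [sum_const, card_univ, Fintype.card_fun, Fintype.card_bool, Fintype.card_fin,
      nsmul_eq_mul, ← pow_mul, Nat.cast_pow, Nat.cast_ofNat]
    rw [mul_comm B N, ← mul_assoc ((1 / 2 : ℝ) ^ (N * B)), ← mul_pow]
    norm_num
  · intro d' _ hd'
    simp [D, hd']
  · simp

/-- The metadata of the packets are independent of the demands. -/
theorem CollusionPrivacy.sum_metaLaw_eq (h : s.CollusionPrivacy PD) (hPD : ∀ d, PD d ≠ 0)
    (hK : 2 ≤ K) (d d' : Demand K N) (p : ∀ k, s.PacketMeta k) :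
    ∑ z, s.metaLaw d z p = ∑ z, s.metaLaw d' z p := by
  have key : ∀ (k : Fin K) (d d' : Demand K N), d k = d' k →
      ∑ z, s.metaLaw d z p = ∑ z, s.metaLaw d' z p := by
    intro k d d' hk
    have h1 := condMutualInfo_eq_zero_of_imp s.prob_nonneg (h {k} (singleton_nonempty k))
      (Y' := fun ω => ω.2.2.2) fun ω ω' e => by
        funext j
        have := congrFun (Prod.ext_iff.1 e).1 j
        exact (Prod.ext_iff.1 this).1
    have h2 := mass_mul_mass_of_condMutualInfo_eq_zero s.prob_nonneg h1
    set r : Demand K N → (({k} : Finset (Fin K)) → Fin N) := fun d j => d j with hr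
    have hrd : r d = r d' := by
      funext ⟨j, hj⟩
      rw [mem_singleton] at hj
      subst hj
      exact hk
    have hval : ∀ d : Demand K N, (∑ z, s.metaLaw d z p) *
        mass (s.prob PD) (fun ω => fun j : ({k} : Finset (Fin K)) => s.D ω j) (r d) =
        mass (s.prob PD) (fun ω => (ω.2.2.2, fun j : ({k} : Finset (Fin K)) => s.D ω j))
          (p, r d) := by
      intro d
      have h3 := h2 d p (r d)
      have e1 : mass (s.prob PD)
          (fun ω => (s.D ω, ω.2.2.2, fun j : ({k} : Finset (Fin K)) => s.D ω j)) (d, p, r d) =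
          mass (s.prob PD) (fun ω => (s.D ω, ω.2.2.2)) (d, p) := mass_congr fun ω => by
        simp only [Prod.mk.injEq]
        exact ⟨fun e => ⟨e.1, e.2.1⟩, fun e => ⟨e.1, e.2, by rw [e.1]⟩⟩
      have e2 : mass (s.prob PD)
          (fun ω => (s.D ω, fun j : ({k} : Finset (Fin K)) => s.D ω j)) (d, r d) =
          mass (s.prob PD) s.D d := mass_congr fun ω => by
        simp only [Prod.mk.injEq]
        exact ⟨fun e => e.1, fun e => ⟨e, by rw [e]⟩⟩
      rw [e1, e2, mass_demand, mass_demand_packetMeta, mul_assoc] at h3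
      exact mul_left_cancel₀ (ENNReal.toReal_ne_zero.2 ⟨hPD d, PD.apply_ne_top d⟩) h3
    have hpos : 0 < mass (s.prob PD)
        (fun ω => fun j : ({k} : Finset (Fin K)) => s.D ω j) (r d) := by
      refine lt_of_lt_of_le (ENNReal.toReal_pos (hPD d) (PD.apply_ne_top d)) ?_
      rw [← mass_demand (s := s)]
      exact mass_mono s.prob_nonneg fun ω e => by rw [e]
    refine mul_right_cancel₀ hpos.ne' ?_
    rw [hval d, hrd, hval d']
  -- Privacy towards a single user compares only demand vectors that agree at this user. An
  -- intermediate vector that agrees with `d` at `k₀` and with `d'` at `k₁` links arbitrary ones.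
  let k₀ : Fin K := ⟨0, by lia⟩
  let k₁ : Fin K := ⟨1, by lia⟩
  have hne : k₁ ≠ k₀ := by simp [k₀, k₁]
  rw [key k₀ d (Function.update d k₁ (d' k₁)) (by rw [Function.update_of_ne hne.symm]),
    key k₁ _ d' (by rw [Function.update_self])]

end Scheme

/-! ### Two groups of users as two transmitters. -/

namespace Scheme

variable {K N B : ℕ} {s : Scheme K N B} {PD : PMF (Demand K N)}
  {bits : ∀ k, s.CacheMeta k → Finset (Fin N × Fin B)}

/-- The payloads of a group of users. -/
def groupPayload (s : Scheme K N B) (G : Finset (Fin K)) (p : ∀ k, s.PacketMeta k)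
    (f : Fin N × Fin B → Bool) (k : G) : List Bool := s.payloadBits k p f

/-- The bits cached by a group of users. -/
def groupCache (bits : ∀ k, s.CacheMeta k → Finset (Fin N × Fin B)) (G : Finset (Fin K))
    (z : ∀ k, s.CacheMeta k) : Finset (Fin N × Fin B) := G.biUnion fun k => bits k (z k)

/-- The bits of all demanded files. -/
def blockBits (B : ℕ) (d : Demand K N) : Finset (Fin N × Fin B) :=
  univ.filter fun i => ∃ k, d k = i.1

theorem groupPayload_dependsOn {z : ∀ k, s.CacheMeta k} {p : ∀ k, s.PacketMeta k}
    (hdep : ∀ k, DependsOn (s.payloadBits k p) (bits k (z k) : Set (Fin N × Fin B)))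
    (G : Finset (Fin K)) :
    DependsOn (s.groupPayload G p) (groupCache bits G z : Set (Fin N × Fin B)) := by
  intro f g h
  funext k
  exact hdep k fun i hi => h i (mem_biUnion.2 ⟨k, k.2, hi⟩)

/-- A group of users decodes all demanded files from the signals of the other users and its own
caches. -/
theorem condEntropy_block_le {G G' : Finset (Fin K)} (hcov : ∀ k, k ∈ G ∨ k ∈ G')
    {d : Demand K N} (hatt : ∀ k, ∃ k' ∈ G', d k' = d k) {z : ∀ k, s.CacheMeta k}
    {p : ∀ k, s.PacketMeta k}
    (hdep : ∀ k, DependsOn (s.payloadBits k p) (bits k (z k) : Set (Fin N × Fin B))) :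
    condEntropy (fair (Fin N × Fin B)) (restr (blockBits B d))
      (fun f => (s.groupPayload G p f, restr (groupCache bits G' z) f)) ≤
      ∑ k, s.userError bits d z p k := by
  have h1 := condEntropy_le_of_imp (P := fair (Fin N × Fin B)) fair_nonneg
    (X := restr (blockBits B d)) (X' := fun f (k : G') => restr (fileBits B (d k)) f)
    (Y := fun f => (s.groupPayload G p f, restr (groupCache bits G' z) f)) fun f g _ h => by
      rw [restr_eq_iff]
      intro i hi
      obtain ⟨k, hk⟩ := (mem_filter.1 hi).2
      obtain ⟨k', hk', e⟩ := hatt k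
      exact restr_eq_iff.1 (congrFun h ⟨k', hk'⟩) i (by simp [fileBits, e, hk])
  refine h1.trans ((condEntropy_tuple_le fair_nonneg (fun k => restr (fileBits B (d k))) _
    G').trans ((sum_le_sum fun k hk => ?_).trans (sum_le_sum_of_subset_of_nonneg (subset_univ G')
      fun k _ _ => userError_nonneg d z p k)))
  refine condEntropy_anti fair_nonneg _ fun f g h => ?_
  simp only [Prod.mk.injEq, restr_eq_iff] at h
  refine Prod.ext ?_ (restr_eq_iff.2 fun i hi => h.2 i (mem_biUnion.2 ⟨k, hk, hi⟩))
  funext j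
  rcases hcov j with hj | hj
  · exact congrFun h.1 ⟨j, hj⟩
  · exact hdep j fun i hi => h.2 i (mem_biUnion.2 ⟨j, hj, hi⟩)

theorem entropy_groups_le {G G' : Finset (Fin K)} (hdisj : Disjoint G G')
    (p : ∀ k, s.PacketMeta k) :
    entropy (fair (Fin N × Fin B)) (s.groupPayload G p) +
      entropy (fair (Fin N × Fin B)) (s.groupPayload G' p) ≤
        ∑ k, entropy (fair (Fin N × Fin B)) (s.payloadBits k p) := by
  have h := fun G => entropy_tuple_le (P := fair (Fin N × Fin B)) fair_nonneg sum_fair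
    (fun k => s.payloadBits k p) G
  refine (add_le_add (h G) (h G')).trans ?_
  rw [← sum_union hdisj]
  exact sum_le_sum_of_subset_of_nonneg (subset_univ _)
    fun k _ _ => entropy_nonneg fair_nonneg sum_fair _

theorem sum_placement_mul (d : Demand K N) (φ : (∀ k, s.CacheMeta k) → ℝ) :
    ∑ z, (s.placement z).toReal * φ z = ∑ z, ∑ p, s.metaLaw d z p * φ z := by
  simp only [← sum_mul, sum_metaLaw]

/-- The signals of `G` carry no information on bits outside the caches of `G`, so a demanded bit
cached in neither group is lost to `G'` and counts as decoding error. -/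
theorem expected_uncached_le {η : ℝ} (henc : s.Encoding PD) (hPD : ∀ d, PD d ≠ 0)
    (hbits : s.IsCacheMap bits) {G G' : Finset (Fin K)} (hcov : ∀ k, k ∈ G ∨ k ∈ G')
    {d : Demand K N} (hatt : ∀ k, ∃ k' ∈ G', d k' = d k)
    (herr : ∑ z, ∑ p, s.metaLaw d z p * ∑ k, s.userError bits d z p k ≤ η) :
    ∑ z, (s.placement z).toReal *
      (#(blockBits B d \ (groupCache bits G z ∪ groupCache bits G' z)) : ℝ) ≤ η := by
  rw [sum_placement_mul d]
  refine (sum_le_sum fun z _ => sum_le_sum fun p _ => ?_).trans herr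
  rcases eq_or_ne (s.metaLaw d z p) 0 with h0 | h0
  · simp [h0]
  refine mul_le_mul_of_nonneg_left ?_ (s.metaLaw_nonneg d z p)
  have hdep := fun k => henc.dependsOn hPD hbits h0 k
  exact (card_sdiff_le_condEntropy (groupPayload_dependsOn hdep G)).trans
    (condEntropy_block_le hcov hatt hdep)

/-- The bits cached in both groups. -/
def commonCache (bits : ∀ k, s.CacheMeta k → Finset (Fin N × Fin B)) (G G' : Finset (Fin K))
    (z : ∀ k, s.CacheMeta k) : Finset (Fin N × Fin B) :=
  groupCache bits G z ∩ groupCache bits G' z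

/-- Inclusion-exclusion for the caches of the two groups, each bounded by the sum of its users'
caches. -/
theorem card_commonCache_le {G G' : Finset (Fin K)} (hdisj : Disjoint G G')
    (z : ∀ k, s.CacheMeta k) :
    (#(commonCache bits G G' z) : ℝ) ≤ ∑ k, (#(bits k (z k)) : ℝ) - N * B +
      #(univ \ (groupCache bits G z ∪ groupCache bits G' z)) := by
  have h1 : ∀ G, #(groupCache bits G z) ≤ ∑ k ∈ G, #(bits k (z k)) := fun G => card_biUnion_le
  have h2 := card_union_add_card_inter (groupCache bits G z) (groupCache bits G' z)
  have h3 := card_sdiff_add_card (univ : Finset (Fin N × Fin B))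
    (groupCache bits G z ∪ groupCache bits G' z)
  rw [union_eq_left.2 (subset_univ _), card_univ, Fintype.card_prod, Fintype.card_fin, Fintype.card_fin] at h3
  have h4 : ∑ k ∈ G, #(bits k (z k)) + ∑ k ∈ G', #(bits k (z k)) ≤ ∑ k, #(bits k (z k)) := by
    rw [← sum_union hdisj]
    exact sum_le_sum_of_subset (subset_univ _)
  have h5 : #(commonCache bits G G' z) + N * B ≤ ∑ k, #(bits k (z k)) +
      #(univ \ (groupCache bits G z ∪ groupCache bits G' z)) := by
    have := h1 G
    have := h1 G'
    simp only [commonCache]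
    lia
  have h6 : (#(commonCache bits G G' z) : ℝ) + N * B ≤ ∑ k, (#(bits k (z k)) : ℝ) +
      #(univ \ (groupCache bits G z ∪ groupCache bits G' z)) := by exact_mod_cast h5
  linarith

theorem sum_card_blockBits_inter {C : Type*} [Fintype C] {m : ℕ} (dem : C → Demand K N)
    (hdem : ∀ x, #{c | ∃ k, dem c k = x} = m) (Q : Finset (Fin N × Fin B)) :
    ∑ c, (#(blockBits B (dem c) ∩ Q) : ℝ) = m * #Q := by
  have h : ∑ c, #(blockBits B (dem c) ∩ Q) = m * #Q := by
    have h1 : ∀ c, #(blockBits B (dem c) ∩ Q) = ∑ i ∈ Q, if ∃ k, dem c k = i.1 then 1 else 0 :=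
      fun c => by
        rw [← card_filter]
        congr 1
        ext i
        simp [blockBits, and_comm]
    rw [sum_congr rfl fun c _ => h1 c, sum_comm]
    simp only [← card_filter, hdem]
    simp [mul_comm]
  exact_mod_cast h

theorem card_blockBits (d : Demand K N) :
    #(blockBits B d) = #{x | ∃ k, d k = x} * B := by
  have : blockBits B d = (univ.filter fun x => ∃ k, d k = x) ×ˢ (univ : Finset (Fin B)) := by
    ext i
    simp [blockBits]
  rw [this, card_product, card_univ, Fintype.card_fin]

/-- Each file is demanded under `m ≥ 1` of the `N` demand vectors, so summing the bound on uncached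
demanded bits over them covers the whole library. -/
theorem expected_commonCache_le {M ε η : ℝ} {m : ℕ} (hm : 0 < m) (henc : s.Encoding PD)
    (hsize : s.CacheSize PD M ε)
    (hPD : ∀ d, PD d ≠ 0) (hbits : s.IsCacheMap bits) {G G' : Finset (Fin K)}
    (hcov : ∀ k, k ∈ G ∨ k ∈ G') (hdisj : Disjoint G G')
    (dem : Fin N → Demand K N) (hatt : ∀ c k, ∃ k' ∈ G', dem c k' = dem c k)
    (hdem : ∀ x, #{c | ∃ k, dem c k = x} = m)
    (herr : ∀ d, ∑ z, ∑ p, s.metaLaw d z p * ∑ k, s.userError bits d z p k ≤ η) :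
    ∑ z, (s.placement z).toReal * (#(commonCache bits G G' z) : ℝ) ≤
      K * (B * (M + ε)) - N * B + N * η := by
  have h1 : ∑ z, (s.placement z).toReal * ∑ k, (#(bits k (z k)) : ℝ) ≤ K * (B * (M + ε)) := by
    simp only [mul_sum]
    rw [sum_comm]
    refine (sum_le_sum fun k _ => hsize.sum_card_le hbits k).trans_eq ?_
    simp
  have h2 : ∑ z, (s.placement z).toReal *
      (#(univ \ (groupCache bits G z ∪ groupCache bits G' z)) : ℝ) ≤ N * η := by
    have h3 := sum_le_sum fun c (_ : c ∈ univ) =>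
      expected_uncached_le henc hPD hbits hcov (hatt c) (herr (dem c))
    rw [sum_const, card_univ, Fintype.card_fin, nsmul_eq_mul, sum_comm] at h3
    refine le_trans (sum_le_sum fun z _ => ?_) h3
    rw [← mul_sum]
    refine mul_le_mul_of_nonneg_left ?_ ENNReal.toReal_nonneg
    have h4 := sum_card_blockBits_inter dem hdem
      (univ \ (groupCache bits G z ∪ groupCache bits G' z))
    have h5 : ∀ c, blockBits B (dem c) ∩ (univ \ (groupCache bits G z ∪ groupCache bits G' z)) =
        blockBits B (dem c) \ (groupCache bits G z ∪ groupCache bits G' z) := fun c => by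
      ext i; simp
    simp only [h5] at h4
    rw [h4]
    exact le_mul_of_one_le_left (Nat.cast_nonneg _) (by exact_mod_cast hm)
  calc _ ≤ ∑ z, (s.placement z).toReal * (∑ k, (#(bits k (z k)) : ℝ) - N * B +
        #(univ \ (groupCache bits G z ∪ groupCache bits G' z))) :=
        sum_le_sum fun z _ => mul_le_mul_of_nonneg_left (card_commonCache_le hdisj z)
          ENNReal.toReal_nonneg
    _ = ∑ z, (s.placement z).toReal * ∑ k, (#(bits k (z k)) : ℝ) - N * B +
        ∑ z, (s.placement z).toReal *
          (#(univ \ (groupCache bits G z ∪ groupCache bits G' z)) : ℝ) := by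
        simp only [mul_add, mul_sub, sum_add_distrib, sum_sub_distrib]
        rw [← sum_mul, sum_toReal_pmf, one_mul]
    _ ≤ _ := by linarith

/-- The load bound from demands of disjoint blocks of files by both groups of users. -/
theorem load_ge_of_blocks {R ε η : ℝ} {m n : ℕ} (hn : 0 < n) (h : ℕ) (hPD : ∀ d, PD d ≠ 0)
    (hK : 2 ≤ K) (henc : s.Encoding PD) (hpriv : s.CollusionPrivacy PD) (hload : s.Load PD R ε)
    (hbits : s.IsCacheMap bits) {G G' : Finset (Fin K)}
    (hcov : ∀ k, k ∈ G ∨ k ∈ G') (hdisj : Disjoint G G')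
    (dem : Fin n → Demand K N) (hatt : ∀ t k, ∃ k' ∈ G, dem t k' = dem t k)
    (hatt' : ∀ t k, ∃ k' ∈ G', dem t k' = dem t k)
    (hdem : ∀ t, #{x | ∃ k, dem t k = x} = m)
    (hne : ∀ t t', t ≠ t' → ∀ k k', dem t k ≠ dem t' k')
    (herr : ∀ d, ∑ z, ∑ p, s.metaLaw d z p * ∑ k, s.userError bits d z p k ≤ η) :
    ∑ i, (bitWeight n h * (m * B - ∑ z, (s.placement z).toReal *
          (#(blockBits B (dem i) ∩ commonCache bits G G' z) : ℝ)) -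
        overlapWeight n h * ∑ j ∈ univ.erase i, ∑ z, (s.placement z).toReal *
          (#(blockBits B (dem j) ∩ commonCache bits G G' z) : ℝ) -
        (1 + overlapWeight n h * n) * (2 * η)) ≤ B * (R + ε) := by
  classical
  set w₀ := bitWeight n h
  set w₁ := overlapWeight n h with hw₁
  have hw₁0 : 0 ≤ 1 + w₁ * n := by
    have := overlapWeight_nonneg n h
    positivity
  set ρ : (∀ k, s.PacketMeta k) → ℝ := fun p => ∑ z, s.metaLaw (dem ⟨0, hn⟩) z p
  have hρ : ∀ d p, ∑ z, s.metaLaw d z p = ρ p := fun d p =>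
    hpriv.sum_metaLaw_eq hPD hK d (dem ⟨0, hn⟩) p
  set φ : Fin n → (∀ k, s.CacheMeta k) → ℝ := fun i z =>
    w₀ * (m * B - (#(blockBits B (dem i) ∩ commonCache bits G G' z) : ℝ)) -
      w₁ * ∑ j ∈ univ.erase i, (#(blockBits B (dem j) ∩ commonCache bits G G' z) : ℝ) with hφ
  set E : Fin n → (∀ k, s.CacheMeta k) → (∀ k, s.PacketMeta k) → ℝ := fun i z p =>
    ∑ k, s.userError bits (dem i) z p k with hE
  have hpoint : ∀ p, ∑ i, ∑ z, s.metaLaw (dem i) z p * (φ i z - (1 + w₁ * n) * (2 * E i z p)) ≤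
      ρ p * ∑ k, entropy (fair (Fin N × Fin B)) (s.payloadBits k p) := by
    intro p
    -- With the packet metadata `p` fixed, the weights of the caches have the same total `ρ p` for
    -- every demand, by privacy. Any choice of caches possible with `p`, one for each demand,
    -- satisfies the two-transmitter bound.
    refine sum_average_le (fun i z => s.metaLaw_nonneg (dem i) z p)
      (sum_nonneg fun z _ => s.metaLaw_nonneg _ z p) (fun i => hρ (dem i) p) fun z hz => ?_
    have hdep := fun i k => henc.dependsOn hPD hbits (hz i) k
    refine le_trans ?_ ((two_transmitter_converse h (V₁ := s.groupPayload G p)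
      (V₂ := s.groupPayload G' p) (A := fun i => groupCache bits G (z i))
      (C := fun i => groupCache bits G' (z i)) (F := fun i => blockBits B (dem i)) ?_
      (fun i => groupPayload_dependsOn (hdep i) G)
      (fun i => groupPayload_dependsOn (hdep i) G')).trans (entropy_groups_le hdisj p))
    · refine sum_le_sum fun i _ => sub_le_sub (le_of_eq ?_) ?_
      · have hc : (#(blockBits B (dem i)) : ℝ) = m * B := by
          rw [card_blockBits, hdem i, Nat.cast_mul]
        simp only [hφ, hc, commonCache]
        rfl
      · refine mul_le_mul_of_nonneg_left ?_ hw₁0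
        have e1 := condEntropy_block_le hcov (hatt' i) (hdep i)
        have e2 := condEntropy_block_le (G := G') (G' := G) (fun k => (hcov k).symm)
          (hatt i) (hdep i)
        simp only [hE]
        linarith
    · intro i j hij
      refine disjoint_left.2 fun b hb hb' => ?_
      obtain ⟨k, hk⟩ := (mem_filter.1 hb).2
      obtain ⟨k', hk'⟩ := (mem_filter.1 hb').2
      exact hne i j hij k k' (hk.trans hk'.symm)
  refine le_trans ?_ ((sum_le_sum fun p (_ : p ∈ univ) => hpoint p).trans
    (hload.sum_entropy_le hρ))
  rw [sum_comm]
  refine sum_le_sum fun i _ => ?_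
  rw [sum_comm (f := fun p z => s.metaLaw (dem i) z p * (φ i z - (1 + w₁ * n) * (2 * E i z p)))]
  simp only [mul_sub, sum_sub_distrib]
  refine sub_le_sub (le_of_eq ?_) ?_
  -- The cache term does not involve `p`; summing over `p` leaves the placement law, which is the
  -- same for all demands.
  · rw [← sum_placement_mul]
    simp only [hφ, mul_sub, sum_sub_distrib, ← sum_mul, sum_toReal_pmf, one_mul]
    congr 1
    · congr 1
      rw [mul_sum]
      exact sum_congr rfl fun z _ => by ring
    · simp only [mul_sum]
      rw [sum_comm]
      exact sum_congr rfl fun z _ => sum_congr rfl fun j _ => by ring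
  · calc _ = (1 + w₁ * n) * (2 * ∑ z, ∑ p, s.metaLaw (dem i) z p * E i z p) := by
          simp only [mul_sum]
          exact sum_congr rfl fun z _ => sum_congr rfl fun p _ => by ring
      _ ≤ _ := mul_le_mul_of_nonneg_left
          (mul_le_mul_of_nonneg_left (herr (dem i)) zero_le_two) hw₁0

/-- The load bound, averaged over cyclic shifts of the demanded files. -/
theorem load_ge_average {M R ε η : ℝ} {m n : ℕ} (hm : 0 < m) (hn : 0 < n) (h : ℕ)
    (hPD : ∀ d, PD d ≠ 0)
    (hK : 2 ≤ K) (hsize : s.CacheSize PD M ε) (henc : s.Encoding PD)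
    (hpriv : s.CollusionPrivacy PD) (hload : s.Load PD R ε)
    (hbits : s.IsCacheMap bits) {G G' : Finset (Fin K)}
    (hcov : ∀ k, k ∈ G ∨ k ∈ G') (hdisj : Disjoint G G')
    (dem : Fin N → Fin n → Demand K N) (hatt : ∀ c t k, ∃ k' ∈ G, dem c t k' = dem c t k)
    (hatt' : ∀ c t k, ∃ k' ∈ G', dem c t k' = dem c t k)
    (hdem : ∀ c t, #{x | ∃ k, dem c t k = x} = m)
    (hshift : ∀ t x, #{c | ∃ k, dem c t k = x} = m)
    (hne : ∀ c t t', t ≠ t' → ∀ k k', dem c t k ≠ dem c t' k')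
    (herr : ∀ d, ∑ z, ∑ p, s.metaLaw d z p * ∑ k, s.userError bits d z p k ≤ η) :
    n * (bitWeight n h * (N * (m * B) - m * (K * (B * (M + ε)) - N * B + N * η)) -
        overlapWeight n h * ((n - 1) * (m * (K * (B * (M + ε)) - N * B + N * η))) -
        N * ((1 + overlapWeight n h * n) * (2 * η))) ≤ N * (B * (R + ε)) := by
  have h1 := sum_le_sum fun c (_ : c ∈ univ) => load_ge_of_blocks hn h hPD hK henc hpriv hload
    hbits hcov hdisj (dem c) (hatt c) (hatt' c) (hdem c) (hne c) herr
  rw [sum_const, card_univ, Fintype.card_fin, nsmul_eq_mul] at h1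
  refine le_trans ?_ h1
  set Q := ∑ z, (s.placement z).toReal * (#(commonCache bits G G' z) : ℝ) with hQ
  have hQle : Q ≤ K * (B * (M + ε)) - N * B + N * η :=
    expected_commonCache_le hm henc hsize hPD hbits hcov hdisj (fun c => dem c ⟨0, hn⟩)
      (fun c k => hatt' c _ k) (hshift ⟨0, hn⟩) herr
  have hq : ∀ t, ∑ c, ∑ z, (s.placement z).toReal *
      (#(blockBits B (dem c t) ∩ commonCache bits G G' z) : ℝ) = m * Q := fun t => by
    rw [sum_comm, hQ, mul_sum]
    refine sum_congr rfl fun z _ => ?_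
    rw [← mul_sum, sum_card_blockBits_inter (fun c => dem c t) (hshift t)]
    ring
  rw [sum_comm]
  simp only [sum_sub_distrib, ← mul_sum, sum_const, card_univ, Fintype.card_fin, nsmul_eq_mul]
  have hq2 : ∀ i, ∑ c, ∑ j ∈ univ.erase i, ∑ z, (s.placement z).toReal *
      (#(blockBits B (dem c j) ∩ commonCache bits G G' z) : ℝ) = (n - 1) * (m * Q) := fun i => by
    rw [sum_comm, sum_congr rfl fun j _ => hq j, sum_const, card_erase_of_mem (mem_univ _),
      card_univ, Fintype.card_fin, nsmul_eq_mul, Nat.cast_pred hn]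
  simp only [hq, hq2, sum_const, card_univ, Fintype.card_fin, nsmul_eq_mul]
  have hb := bitWeight_nonneg n h
  have ho := overlapWeight_nonneg n h
  have hn1 : (0 : ℝ) ≤ n - 1 := by
    have : (1 : ℝ) ≤ n := by exact_mod_cast hn
    linarith
  have hmQ := mul_le_mul_of_nonneg_left hQle (Nat.cast_nonneg (α := ℝ) m)
  have hA := mul_le_mul_of_nonneg_left hmQ (mul_nonneg (Nat.cast_nonneg (α := ℝ) n) hb)
  have hB := mul_le_mul_of_nonneg_left hmQ
    (mul_nonneg (mul_nonneg (Nat.cast_nonneg (α := ℝ) n) ho) hn1)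
  linarith

end Scheme

open Filter Topology

/-! ### Demands of disjoint blocks of files -/

section Demands

theorem block_index_lt {N m n t a : ℕ} (hmn : n * m ≤ N) (ht : t < n) (ha : a < m) :
    t * m + a < N := by
  have : (t + 1) * m ≤ n * m := Nat.mul_le_mul_right m ht
  rw [add_mul, one_mul] at this
  lia

variable {K N : ℕ} [NeZero N]

/-- User `k` demands the file number `c + t * m + k % m`, modulo `N`. -/
def shiftDemand (K : ℕ) (m n : ℕ) (c : Fin N) (t : Fin n) : Demand K N :=
  fun k => c + Fin.ofNat N (t * m + k % m)

theorem ofNat_injOn {a b : ℕ} (ha : a < N) (hb : b < N) (h : Fin.ofNat N a = Fin.ofNat N b) :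
    a = b := by
  have := congrArg Fin.val h
  simpa [Fin.ofNat, Nat.mod_eq_of_lt ha, Nat.mod_eq_of_lt hb] using this

theorem exists_user_iff {m n : ℕ} (hm : 0 < m) (hmK : 2 * m ≤ K) {c x : Fin N} {t : Fin n} :
    (∃ k, shiftDemand K m n c t k = x) ↔
      ∃ a : Fin m, c + Fin.ofNat N (t * m + a) = x := by
  constructor
  · rintro ⟨k, hk⟩
    exact ⟨⟨k % m, Nat.mod_lt _ hm⟩, hk⟩
  · rintro ⟨a, ha⟩
    refine ⟨⟨a, by lia⟩, ?_⟩
    simpa [shiftDemand, Nat.mod_eq_of_lt a.2] using ha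

theorem block_injective {m n : ℕ} (hmn : n * m ≤ N) (t : Fin n) :
    Function.Injective fun a : Fin m => Fin.ofNat N (t * m + a) := fun a b h => by
  have := ofNat_injOn (block_index_lt hmn t.2 a.2) (block_index_lt hmn t.2 b.2) h
  exact Fin.ext (by lia)

theorem card_demanded {m n : ℕ} (hm : 0 < m) (hmK : 2 * m ≤ K) (hmn : n * m ≤ N) (c : Fin N)
    (t : Fin n) : #{x | ∃ k, shiftDemand K m n c t k = x} = m := by
  have : (univ.filter fun x => ∃ k, shiftDemand K m n c t k = x) =
      univ.image fun a : Fin m => c + Fin.ofNat N (t * m + a) := by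
    ext x
    simp [exists_user_iff hm hmK]
  rw [this, card_image_of_injective _ fun a b h => block_injective hmn t (add_left_cancel h),
    card_univ, Fintype.card_fin]

theorem card_demanding {m n : ℕ} (hm : 0 < m) (hmK : 2 * m ≤ K) (hmn : n * m ≤ N) (t : Fin n)
    (x : Fin N) : #{c | ∃ k, shiftDemand K m n c t k = x} = m := by
  have : (univ.filter fun c => ∃ k, shiftDemand K m n c t k = x) =
      univ.image fun a : Fin m => x - Fin.ofNat N (t * m + a) := by
    ext c
    simp only [mem_filter, mem_univ, true_and, mem_image, exists_user_iff hm hmK]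
    exact exists_congr fun a => ⟨fun h => by rw [← h, add_sub_cancel_right],
      fun h => by rw [← h, sub_add_cancel]⟩
  rw [this, card_image_of_injective _ fun a b h => block_injective hmn t (sub_right_injective h),
    card_univ, Fintype.card_fin]

theorem shiftDemand_ne {m n : ℕ} (hm : 0 < m) (hmn : n * m ≤ N) (c : Fin N) {t t' : Fin n}
    (ht : t ≠ t') (k k' : Fin K) : shiftDemand K m n c t k ≠ shiftDemand K m n c t' k' := by
  intro h
  have h1 := ofNat_injOn (block_index_lt hmn t.2 (Nat.mod_lt k hm))
    (block_index_lt hmn t'.2 (Nat.mod_lt k' hm)) (add_left_cancel h)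
  refine ht (Fin.ext ?_)
  have h2 := congrArg (· / m) h1
  simpa [add_comm _ (_ % m), Nat.add_mul_div_right _ _ hm,
    Nat.div_eq_of_lt (Nat.mod_lt _ hm)] using h2

theorem exists_low_user {m n : ℕ} (hm : 0 < m) (hmK : 2 * m ≤ K) (c : Fin N) (t : Fin n)
    (k : Fin K) : ∃ k' ∈ univ.filter fun k : Fin K => (k : ℕ) < m,
      shiftDemand K m n c t k' = shiftDemand K m n c t k := by
  have hk := Nat.mod_lt k hm
  refine ⟨⟨k % m, by lia⟩, by simpa using hk, ?_⟩
  simp [shiftDemand]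

theorem exists_high_user {m n : ℕ} (hm : 0 < m) (hmK : 2 * m ≤ K) (c : Fin N) (t : Fin n)
    (k : Fin K) : ∃ k' ∈ univ.filter fun k : Fin K => ¬ (k : ℕ) < m,
      shiftDemand K m n c t k' = shiftDemand K m n c t k := by
  have hk := Nat.mod_lt k hm
  refine ⟨⟨k % m + m, by lia⟩, by simp, ?_⟩
  simp [shiftDemand]

end Demands

/-- The bound for `n` disjoint blocks of `m` files. -/
theorem AchievableUC.bound {K N : ℕ} (hN : 0 < N) (hK : 2 ≤ K) {PD : PMF (Demand K N)}
    (hPD : ∀ d, PD d ≠ 0) {M y R : ℝ} (hM : K * M = N + 2 * y) (hR : AchievableUC K N PD M R)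
    {m n : ℕ} (hm : 0 < m) (hn : 0 < n) (hmK : 2 * m ≤ K) (hmn : n * m ≤ N) (h : ℕ) :
    n * (bitWeight n h * (N * m - m * (2 * y)) - overlapWeight n h * ((n - 1) * (m * (2 * y)))) ≤
      N * R := by
  have : NeZero N := ⟨hN.ne'⟩
  obtain ⟨ε, hε0, hε, hev⟩ := hR
  -- `κ` dominates every `1 / PD d` and does not depend on `B`, so the error per bit `K * κ * ε B`
  -- tends to `0`.
  set κ : ℝ := ∑ d, (PD d).toReal⁻¹ with hκ
  set q : ℝ → ℝ := fun e => 2 * y + K * e + N * (K * κ * e) with hq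
  set f : ℝ → ℝ := fun e => n * (bitWeight n h * (N * m - m * q e) -
    overlapWeight n h * ((n - 1) * (m * q e)) -
    N * ((1 + overlapWeight n h * n) * (2 * (K * κ * e)))) with hf
  have hfε : Tendsto (fun B => f (ε B)) atTop (𝓝 (f 0)) := by
    have hc : Continuous f := by fun_prop
    exact (hc.tendsto 0).comp hε
  have hgε : Tendsto (fun B => N * (R + ε B)) atTop (𝓝 (N * (R + 0))) :=
    (tendsto_const_nhds.add hε).const_mul _
  have hle : ∀ᶠ B in atTop, f (ε B) ≤ N * (R + ε B) := by
    filter_upwards [hev, eventually_gt_atTop 0] with B ⟨s, hunc, hsize, henc, hdec, hpriv, hload⟩ hB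
    obtain ⟨bits, hbits⟩ := hunc.exists_cacheMap
    have hB' : (0 : ℝ) < B := by exact_mod_cast hB
    have herr : ∀ d, ∑ z, ∑ p, s.metaLaw d z p * ∑ k, s.userError bits d z p k ≤
        K * (B * ε B) * κ := fun d => by
      refine (hdec.sum_userError_le hbits hPD d).trans (mul_le_mul_of_nonneg_left ?_ ?_)
      · exact single_le_sum (f := fun d => (PD d).toReal⁻¹)
          (fun d _ => inv_nonneg.2 ENNReal.toReal_nonneg) (mem_univ d)
      · have := hε0 B
        positivity
    have key := Scheme.load_ge_average hm hn h hPD hK hsize henc hpriv hload hbits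
      (G := univ.filter fun k : Fin K => (k : ℕ) < m)
      (G' := univ.filter fun k : Fin K => ¬ (k : ℕ) < m)
      (fun k => by simpa using lt_or_ge (k : ℕ) m) (disjoint_filter_filter_not _ _ _)
      (shiftDemand K m n) (exists_low_user hm hmK) (exists_high_user hm hmK)
      (card_demanded hm hmK hmn) (card_demanding hm hmK hmn)
      (fun c t t' ht => shiftDemand_ne hm hmn c ht) herr
    refine le_of_mul_le_mul_left ?_ hB'
    refine le_trans (le_of_eq ?_) (key.trans_eq (by ring))
    have hQ : (K : ℝ) * (B * (M + ε B)) - N * B + N * (K * (B * ε B) * κ) = B * q (ε B) := by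
      have : (K : ℝ) * (B * (M + ε B)) = B * (K * M) + B * (K * ε B) := by ring
      rw [this, hM]
      simp only [hq]
      ring
    rw [hQ]
    simp only [hf]
    ring
  have hlim := le_of_tendsto_of_tendsto hfε hgε hle
  simpa [hf, hq] using hlim

/-- The lower bound on the load per demanded file and pair of groups, for `t` blocks. -/
noncomputable def blockBound (h : ℕ) (u t : ℝ) : ℝ :=
  (h + 2 * t) / (h + 2) * (1 - u) - (2 * h + t) * (t - 1) / ((h + 1) * (h + 2)) * u

theorem AchievableUC.blockBound_le {K N : ℕ} (hN : 0 < N) (hK : 2 ≤ K) {PD : PMF (Demand K N)}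
    (hPD : ∀ d, PD d ≠ 0) {M y R : ℝ} (hM : K * M = N + 2 * y) (hR : AchievableUC K N PD M R)
    {m n : ℕ} (hm : 0 < m) (hn : 0 < n) (hmK : 2 * m ≤ K) (hmn : n * m ≤ N) (h : ℕ) :
    m * blockBound h (2 * y / N) n ≤ R := by
  have hb := hR.bound hN hK hPD hM hm hn hmK hmn h
  have hN' : (0 : ℝ) < N := by exact_mod_cast hN
  have hn' : (0 : ℝ) < n := by exact_mod_cast hn
  refine le_of_mul_le_mul_left (le_trans (le_of_eq ?_) hb) hN'
  rw [blockBound, bitWeight, overlapWeight]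
  field_simp

/-- As a quadratic in `t`, `blockBound h u t` has nonnegative constant term and nonpositive leading
coefficient, so its quotient by `t` does not increase. This pays for replacing `2N/K` by its floor.
-/
theorem mul_blockBound_le {h : ℕ} {u a b : ℝ} (hu0 : 0 ≤ u) (hu1 : u ≤ 1) (ha : 0 ≤ a)
    (hab : a ≤ b) : a * blockBound h u b ≤ b * blockBound h u a := by
  have key : b * blockBound h u a - a * blockBound h u b =
      (b - a) * ((h + 1) * h * (1 - u) + 2 * h * u + u * a * b) / ((h + 1) * (h + 2)) := by
    rw [blockBound, blockBound]
    field_simp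
    ring
  have h1 : 0 ≤ 1 - u := by linarith
  have h2 : 0 ≤ b - a := by linarith
  have h3 : 0 ≤ b := ha.trans hab
  rw [← sub_nonneg, key]
  positivity

/-! ### Rounding of `K / 2` and `2N/K`, and the final bounds. -/

theorem floor_half (K : ℕ) : ⌊(K : ℝ) / 2⌋ = ((K / 2 : ℕ) : ℤ) := by
  have h1 : 2 * (K / 2) ≤ K := Nat.mul_div_le K 2
  have h2 : K < 2 * (K / 2) + 2 := by lia
  have h1' : (2 : ℝ) * (K / 2 : ℕ) ≤ K := by exact_mod_cast h1
  have h2' : (K : ℝ) < 2 * (K / 2 : ℕ) + 2 := by exact_mod_cast h2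
  rw [Int.floor_eq_iff, Int.cast_natCast]
  constructor <;> linarith

/-- The factor for an uneven division of the users is at most the size of the smaller group. -/
theorem half_ratio_mul_le {K : ℕ} (hK : 0 < K) {g : ℝ} (hg : 0 ≤ g) :
    (⌊(K : ℝ) / 2⌋ : ℝ) / (⌈(K : ℝ) / 2⌉ : ℝ) * ((K : ℝ) / 2 * g) ≤ (K / 2 : ℕ) * g := by
  have hK' : (0 : ℝ) < (K : ℝ) / 2 := by positivity
  have hc := Int.le_ceil ((K : ℝ) / 2)
  have hc0 := hK'.trans_le hc
  rw [floor_half, Int.cast_natCast, div_mul_eq_mul_div, div_le_iff₀ hc0]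
  calc _ = ((K / 2 : ℕ) : ℝ) * g * ((K : ℝ) / 2) := by ring
    _ ≤ _ := mul_le_mul_of_nonneg_left hc (by positivity)

theorem half_ratio_nonneg (K : ℕ) : (0 : ℝ) ≤ (⌊(K : ℝ) / 2⌋ : ℝ) / (⌈(K : ℝ) / 2⌉ : ℝ) := by
  have h1 : 0 ≤ ⌊(K : ℝ) / 2⌋ := Int.floor_nonneg.2 (by positivity)
  have h2 : 0 ≤ ⌈(K : ℝ) / 2⌉ := Int.ceil_nonneg (by positivity)
  have h1' : (0 : ℝ) ≤ (⌊(K : ℝ) / 2⌋ : ℝ) := by exact_mod_cast h1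
  have h2' : (0 : ℝ) ≤ (⌈(K : ℝ) / 2⌉ : ℝ) := by exact_mod_cast h2
  positivity

/-- The comparison of factors needs `g ≥ 0`; for negative `g` the claim follows from `R ≥ 0`. -/
theorem half_ratio_mul_le_of_le {K : ℕ} (hK : 0 < K) {g R : ℝ} (hR : 0 ≤ R)
    (hg : (K / 2 : ℕ) * g ≤ R) :
    (⌊(K : ℝ) / 2⌋ : ℝ) / (⌈(K : ℝ) / 2⌉ : ℝ) * ((K : ℝ) / 2 * g) ≤ R := by
  rcases le_total 0 g with h | h
  · exact (half_ratio_mul_le hK h).trans hg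
  · exact (mul_nonpos_of_nonneg_of_nonpos (half_ratio_nonneg K)
      (mul_nonpos_of_nonneg_of_nonpos (by positivity) h)).trans hR

end D2D

theorem theorem5 (K N : ℕ) (hK : 3 ≤ K) (hKN : K ≤ N)
    (PD : PMF (D2D.Demand K N)) (hPD : ∀ d : D2D.Demand K N, PD d ≠ 0)
    (y M : ℝ) (hy : y ∈ Set.Icc (0 : ℝ) ((N : ℝ) / 2))
    (hM : M = (N : ℝ) / (K : ℝ) + 2 * y / (K : ℝ)) :
    (∀ h : ℕ, (h : ℤ) ≤ ⌊2 * (N : ℝ) / (K : ℝ) - 3⌋ →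
      (((⌊(K : ℝ) / 2⌋ : ℝ) / (⌈(K : ℝ) / 2⌉ : ℝ) *
          ((⌊2 * (N : ℝ) / (K : ℝ)⌋ : ℝ) / (2 * (N : ℝ) / (K : ℝ))) *
          ((N : ℝ) - 2 * y - (4 * y + ((N : ℝ) - (K : ℝ) / 2) * (h : ℝ)) / ((h : ℝ) + 2) +
            ((h : ℝ) ^ 2 * ((N : ℝ) - (K : ℝ) / 2) - (N : ℝ) * (2 * (N : ℝ) / (K : ℝ) - 3) +
                (h : ℝ) * ((N : ℝ) + (K : ℝ) / 2)) /
              (((h : ℝ) + 1) * ((h : ℝ) + 2)) * (2 * y / (N : ℝ))) : ℝ) : EReal) ≤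
        D2D.optimalLoadUC K N PD M) ∧
    (((⌊(K : ℝ) / 2⌋ : ℝ) / (⌈(K : ℝ) / 2⌉ : ℝ) *
        ((K : ℝ) * (1 - 3 * y / (N : ℝ))) : ℝ) : EReal) ≤ D2D.optimalLoadUC K N PD M ∧
    (((⌊(K : ℝ) / 2⌋ : ℝ) / (⌈(K : ℝ) / 2⌉ : ℝ) *
        ((K : ℝ) * (1 / 2 - y / (N : ℝ))) : ℝ) : EReal) ≤ D2D.optimalLoadUC K N PD M := by
  have hK0 : 0 < K := by lia
  have hN0 : 0 < N := by lia
  have hKr : (0 : ℝ) < K := by exact_mod_cast hK0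
  have hNr : (0 : ℝ) < N := by exact_mod_cast hN0
  have hKM : K * M = N + 2 * y := by rw [hM]; field_simp
  have hm : 0 < K / 2 := Nat.div_pos (by lia) two_pos
  have hmK : 2 * (K / 2) ≤ K := Nat.mul_div_le K 2
  set u := 2 * y / (N : ℝ) with hu
  have hu0 : 0 ≤ u := div_nonneg (by linarith [hy.1]) hNr.le
  have hu1 : u ≤ 1 := by rw [hu, div_le_one hNr]; linarith [hy.2]
  have main : ∀ R, D2D.AchievableUC K N PD M R → ∀ n h : ℕ, 0 < n → n * (K / 2) ≤ N →
      ((K / 2 : ℕ) : ℝ) * D2D.blockBound h u n ≤ R := fun R hR n h hn hmn =>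
    hR.blockBound_le hN0 (by lia) hPD hKM hm hn hmK hmn h
  have hone : D2D.blockBound 0 u 1 = 1 - u := by rw [D2D.blockBound]; norm_num
  have htwo : D2D.blockBound 0 u 2 = 2 - 3 * u := by rw [D2D.blockBound]; norm_num; ring
  have hRone : ∀ R, D2D.AchievableUC K N PD M R → ((K / 2 : ℕ) : ℝ) * (1 - u) ≤ R :=
    fun R hR => by
      have := main R hR 1 0 one_pos (by lia)
      rwa [Nat.cast_one, hone] at this
  have hR0 : ∀ R, D2D.AchievableUC K N PD M R → 0 ≤ R := fun R hR =>
    le_trans (mul_nonneg (Nat.cast_nonneg _) (by linarith)) (hRone R hR)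
  have hinf : ∀ x : ℝ, (∀ R, D2D.AchievableUC K N PD M R → x ≤ R) →
      (x : EReal) ≤ D2D.optimalLoadUC K N PD M := fun x hx => by
    refine le_sInf ?_
    rintro _ ⟨R, hR, rfl⟩
    exact EReal.coe_le_coe_iff.2 (hx R hR)
  refine ⟨fun h _ => hinf _ fun R hR => ?_, hinf _ fun R hR => ?_, hinf _ fun R hR => ?_⟩
  · set T := 2 * (N : ℝ) / (K : ℝ) with hT
    have hT2 : 2 ≤ T := by
      rw [hT, le_div_iff₀ hKr]
      have : (K : ℝ) ≤ N := by exact_mod_cast hKN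
      linarith
    have hT0 : 0 < T := by linarith
    obtain ⟨n, hn⟩ := Int.eq_ofNat_of_zero_le (Int.floor_nonneg.2 hT0.le)
    have hnT : (n : ℝ) ≤ T := by
      have := Int.floor_le T
      rw [hn] at this
      exact_mod_cast this
    have hn0 : 0 < n := by
      have : (1 : ℤ) ≤ ⌊T⌋ := Int.le_floor.2 (by push_cast; linarith)
      lia
    have hmn : n * (K / 2) ≤ N := by
      have h1 : ((K / 2 : ℕ) : ℝ) ≤ K / 2 := Nat.cast_div_le
      have h2 : (n : ℝ) * ((K / 2 : ℕ) : ℝ) ≤ N := by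
        calc (n : ℝ) * ((K / 2 : ℕ) : ℝ) ≤ T * (K / 2) :=
              mul_le_mul hnT h1 (Nat.cast_nonneg _) hT0.le
          _ = N := by rw [hT]; field_simp
      exact_mod_cast h2
    -- The bracket in the claim is the block bound at the possibly fractional number `T = 2N/K` of
    -- blocks of `K / 2` files.
    have hbr : (N : ℝ) - 2 * y - (4 * y + ((N : ℝ) - (K : ℝ) / 2) * (h : ℝ)) / ((h : ℝ) + 2) +
        ((h : ℝ) ^ 2 * ((N : ℝ) - (K : ℝ) / 2) - (N : ℝ) * (T - 3) +
          (h : ℝ) * ((N : ℝ) + (K : ℝ) / 2)) / (((h : ℝ) + 1) * ((h : ℝ) + 2)) * u =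
        K / 2 * D2D.blockBound h u T := by
      have hyu : y = N * u / 2 := by rw [hu]; field_simp
      have hNT : (N : ℝ) = K / 2 * T := by rw [hT]; field_simp
      rw [hyu, D2D.blockBound, hNT]
      field_simp
      ring
    rw [hbr, hn, Int.cast_natCast, mul_assoc, mul_left_comm ((n : ℝ) / T)]
    refine D2D.half_ratio_mul_le_of_le hK0 (hR0 R hR)
      (le_trans (mul_le_mul_of_nonneg_left ?_ (Nat.cast_nonneg _)) (main R hR n h hn0 hmn))
    rw [div_mul_eq_mul_div, div_le_iff₀ hT0, mul_comm _ T]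
    exact D2D.mul_blockBound_le hu0 hu1 (Nat.cast_nonneg n) hnT
  -- Two blocks fit because `2 * (K / 2) ≤ K ≤ N`; with `h = 0` they give the factor `2 - 3 * u`.
  · have h2 := main R hR 2 0 two_pos (by lia)
    rw [Nat.cast_ofNat, htwo] at h2
    have e : (K : ℝ) * (1 - 3 * y / N) = K / 2 * (2 - 3 * u) := by rw [hu]; ring
    rw [e]
    exact D2D.half_ratio_mul_le_of_le hK0 (hR0 R hR) h2
  · have e : (K : ℝ) * (1 / 2 - y / N) = K / 2 * (1 - u) := by rw [hu]; ring
    rw [e]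
    exact D2D.half_ratio_mul_le_of_le hK0 (hR0 R hR) (hRone R hR)
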